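/- Let $\omega=e^{-i\pi/3}$ and let $PU(2,1)$ be the projective unitary group of the Hermitian form $\langle z,w\rangle=z_1\bar w_3+z_2\bar w_2+z_3\bar w_1$ on $\mathbb C^3$. It acts on the complex hyperbolic plane $\{\langle z,z\rangle<0\}\subset\mathbb{CP}^2$ and on its boundary $\{\langle z,z\rangle=0\}$. The boundary is identified with $\mathfrak N\cup\{\infty\}$, where $\mathfrak N=\mathbb C\times\mathbb R$ is the Heisenberg group with product $[z,t]\cdot[z',t']=[z+z',\,t+t'+2\,\mathrm{Im}(z\bar z')]$, by $[z,t]\mapsto\bigl(\tfrac{-|z|^2+it}{2}:z:1\bigr)$ and $\infty\mapsto(1:0:0)$. An element of $PU(2,1)$ is the Heisenberg translation by $a\in\mathfrak N$ if it fixes $\infty$ and acts on $\mathfrak N$ as the left translation by $a$. It is parabolic if it has no fixed point in the complex hyperbolic plane and exactly one fixed point on the boundary. Consider the ideal points $p_1=\infty$, $q_2=[0,0]$, $q_1=[1,-\sqrt3]$, $p_2=[\omega,-\sqrt3]$, $q_3=[-\bar\omega,\sqrt3]$, the two tetrahedra with vertices $p_1,p_2,q_1,q_2$ and $p_1,p_2,q_2,q_3$,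 which have the face $p_1p_2q_2$ in common, and the elements of $PU(2,1)$ given by $$G_1=\begin{pmatrix}1&\omega&-\omega\\0&1&-\bar\omega\\0&0&1\end{pmatrix},\quad G_2=\begin{pmatrix}1&1&-\omega\\-1&0&-\bar\omega\\-\bar\omega&\omega&1\end{pmatrix},\quad G_3=\begin{pmatrix}1&1&-\omega\\-\omega&\bar\omega&-1-\bar\omega\\-\bar\omega&0&1+\omega\end{pmatrix}.$$ These are side pairings: $G_1$ maps $(q_2,q_1,p_1)$ to $(q_3,p_2,p_1)$, $G_2$ maps $(p_2,q_1,q_2)$ to $(p_1,q_2,q_3)$, and $G_3$ maps $(q_1,p_2,p_1)$ to $(q_2,p_2,q_3)$. Gluing the remaining six faces in this way gives Thurston's ideal triangulation of the complement of the figure eight knot. Its boundary torus is the link of the single ideal vertex: it is made of eight triangles, one for each vertex of each tetrahedron. Fix as base the triangle at the vertex $q_2$ of the first tetrahedron. The holonomy of a closed path in the link is obtained by developing the tetrahedra along the path: it is the product, in the order of the path, of a factor $G_i^{-1}$ for each crossing of the $i$-th glued face from the first tetrahedron to the second, a factor $G_i$ for each crossing in the opposite direction, and a factor $1$ for each crossing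 of the common face. Then the holonomy is a well-defined homomorphism from the fundamental group of the boundary torus to $PU(2,1)$. It is faithful, and it is parabolic: every nontrivial element is mapped to a parabolic element. Its image is generated by $$H_1=G_1^{-1}G_3G_1^{-1}G_2G_3^{-1}G_1G_3^{-1}\quad\text{and}\quad H_2=G_2^{-1}G_1 .$$ The isometry $\kappa:(z_1:z_2:z_3)\mapsto(z_3:\bar\omega z_2:z_1)$ sends the vertex $q_2=[0,0]$ to $\infty$, and after conjugation by $\kappa$ the elements $H_1$, $H_2$ and $H_1H_2^2$ are the Heisenberg translations by $[2\omega,2\sqrt3]$, by $[-\omega,\sqrt3]$ and by $[0,4\sqrt3]$ (a vertical translation). The elements $[2\omega,2\sqrt3]$ and $[-\omega,\sqrt3]$ generate a discrete subgroup of $\mathfrak N$ that is isomorphic to $\mathbb Z^2$ and contains $[0,4\sqrt3]$; this subgroup is also generated by $[-\omega,\sqrt3]$ and $[0,4\sqrt3]$. -/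

import Mathlib

open scoped Matrix MatrixGroups LinearAlgebra.Projectivization ComplexConjugate

noncomputable section

namespace FigEight

/-! ### Complex hyperbolic plane, `PU(2,1)` and the Heisenberg group -/

/-- The complex projective plane. -/
abbrev CP2 : Type := ℙ ℂ (Fin 3 → ℂ)

/-- The Gram matrix of the Hermitian form `z₁ w̄₃ + z₂ w̄₂ + z₃ w̄₁` of signature `(2,1)`. -/
def J : Matrix (Fin 3) (Fin 3) ℂ := !![0, 0, 1; 0, 1, 0; 1, 0, 0]

/-- The Hermitian form `⟨z, w⟩ = z₁ w̄₃ + z₂ w̄₂ + z₃ w̄₁`. -/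
def herm (z w : Fin 3 → ℂ) : ℂ := z 0 * conj (w 2) + z 1 * conj (w 1) + z 2 * conj (w 0)

/-- The complex hyperbolic plane: the negative points of the projective plane
(`⟨v, v⟩` is always real, and its sign does not depend on the representative `v`). -/
def hyperbolicPlane : Set CP2 := {x | (herm x.rep x.rep).re < 0}

/-- The boundary of the complex hyperbolic plane: the null points of the projective plane. -/
def hyperbolicBoundary : Set CP2 := {x | herm x.rep x.rep = 0}

/-- The unitary group `U(2,1)` of the Hermitian form. -/
def U21 : Subgroup (GL (Fin 3) ℂ) where
  carrier := {g | (g : Matrix (Fin 3) (Fin 3) ℂ)ᴴ * J * (g : Matrix (Fin 3) (Fin 3) ℂ) = J}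
  one_mem' := by simp
  mul_mem' := by
    intro a b ha hb
    simp only [Set.mem_ofPred_eq, Units.val_mul, Matrix.conjTranspose_mul] at ha hb ⊢
    calc _ = (b : Matrix (Fin 3) (Fin 3) ℂ)ᴴ *
          ((a : Matrix (Fin 3) (Fin 3) ℂ)ᴴ * J * (a : Matrix (Fin 3) (Fin 3) ℂ)) *
          (b : Matrix (Fin 3) (Fin 3) ℂ) := by simp only [Matrix.mul_assoc]
      _ = J := by rw [ha, hb]
  inv_mem' := by
    intro a ha
    simp only [Set.mem_ofPred_eq] at ha ⊢
    have h1 : (a : Matrix (Fin 3) (Fin 3) ℂ) * ((a⁻¹ : GL (Fin 3) ℂ) : Matrix (Fin 3) (Fin 3) ℂ)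
        = 1 := Units.mul_inv a
    have h2 : ((a⁻¹ : GL (Fin 3) ℂ) : Matrix (Fin 3) (Fin 3) ℂ)ᴴ *
        (a : Matrix (Fin 3) (Fin 3) ℂ)ᴴ = 1 := by
      rw [← Matrix.conjTranspose_mul, h1, Matrix.conjTranspose_one]
    calc _ = ((a⁻¹ : GL (Fin 3) ℂ) : Matrix (Fin 3) (Fin 3) ℂ)ᴴ *
          ((a : Matrix (Fin 3) (Fin 3) ℂ)ᴴ * J * (a : Matrix (Fin 3) (Fin 3) ℂ)) *
          ((a⁻¹ : GL (Fin 3) ℂ) : Matrix (Fin 3) (Fin 3) ℂ) := by rw [ha]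
      _ = (((a⁻¹ : GL (Fin 3) ℂ) : Matrix (Fin 3) (Fin 3) ℂ)ᴴ *
          (a : Matrix (Fin 3) (Fin 3) ℂ)ᴴ) * J * ((a : Matrix (Fin 3) (Fin 3) ℂ) *
          ((a⁻¹ : GL (Fin 3) ℂ) : Matrix (Fin 3) (Fin 3) ℂ)) := by simp only [Matrix.mul_assoc]
      _ = J := by rw [h1, h2, Matrix.one_mul, Matrix.mul_one]

/-- `PU(2,1)`, the image of `U(2,1)` in `PGL(3, ℂ)`. It acts on the projective plane. -/
def PU21 : Subgroup PGL(3, ℂ) := U21.map Matrix.ProjGenLinGroup.mk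

/-- A matrix that preserves the Hermitian form, as an element of `U(2,1)`. -/
def toU21 (M : Matrix (Fin 3) (Fin 3) ℂ) (h : Mᴴ * J * M = J) : U21 :=
  have hl : J * Mᴴ * J * M = 1 := by
    have hJ : J * J = 1 := by ext i j; fin_cases i <;> fin_cases j <;> simp [J]
    rw [Matrix.mul_assoc, Matrix.mul_assoc, ← Matrix.mul_assoc Mᴴ, h, hJ]
  ⟨⟨M, J * Mᴴ * J, mul_eq_one_comm.1 hl, hl⟩, h⟩

/-- The class in `PU(2,1)` of a matrix that preserves the Hermitian form. -/
def toPU21 (M : Matrix (Fin 3) (Fin 3) ℂ) (h : Mᴴ * J * M = J) : PU21 :=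
  ⟨Matrix.ProjGenLinGroup.mk (toU21 M h : GL (Fin 3) ℂ),
    Subgroup.mem_map_of_mem _ (toU21 M h).2⟩

/-- An element of `PU(2,1)` is parabolic if it has no fixed point in the complex hyperbolic plane
and exactly one fixed point in its boundary. -/
def IsParabolic (g : PU21) : Prop :=
  (∀ x ∈ hyperbolicPlane, g • x ≠ x) ∧ ∃! x : CP2, x ∈ hyperbolicBoundary ∧ g • x = x

/-- The Heisenberg group, as a set `ℂ × ℝ`. -/
@[ext] structure Heis where
  z : ℂ
  t : ℝ

namespace Heis

instance : Mul Heis := ⟨fun a b => ⟨a.z + b.z, a.t + b.t + 2 * (a.z * conj b.z).im⟩⟩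
instance : One Heis := ⟨⟨0, 0⟩⟩
instance : Inv Heis := ⟨fun a => ⟨-a.z, -a.t⟩⟩

/-- The group law `(z,t)(z',t') = (z + z', t + t' + 2 Im (z z̄'))`. -/
instance : Group Heis :=
  Group.ofLeftAxioms
    (by
      intro a b c
      ext1
      · exact add_assoc _ _ _
      · change a.t + b.t + 2 * (a.z * conj b.z).im + c.t + 2 * ((a.z + b.z) * conj c.z).im
          = a.t + (b.t + c.t + 2 * (b.z * conj c.z).im) + 2 * (a.z * conj (b.z + c.z)).im
        simp only [map_add, mul_add, add_mul, Complex.add_im]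
        ring)
    (by
      intro a
      ext1
      · exact zero_add _
      · change 0 + a.t + 2 * (0 * conj a.z).im = a.t
        simp)
    (by
      intro a
      ext1
      · exact neg_add_cancel _
      · change -a.t + a.t + 2 * (-a.z * conj a.z).im = 0
        simp only [neg_mul, Complex.mul_conj, Complex.neg_im, Complex.ofReal_im]
        ring)

/-- The topology of `ℂ × ℝ`. -/
instance : TopologicalSpace Heis :=
  TopologicalSpace.induced (fun a : Heis => (a.z, a.t)) inferInstance

end Heis

/-- The lift `((-|z|² + it)/2, z, 1)` of a point of the Heisenberg group. -/
def heisVec (p : Heis) : Fin 3 → ℂ :=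
  ![(-((‖p.z‖ ^ 2 : ℝ) : ℂ) + Complex.I * (p.t : ℂ)) / 2, p.z, 1]

/-- Stereographic projection: the identification of the one-point compactification of the
Heisenberg group with the boundary of the complex hyperbolic plane. -/
def stereo (p : OnePoint Heis) : CP2 :=
  p.elim
    (Projectivization.mk ℂ ![1, 0, 0] (fun h => one_ne_zero (congrFun h 0)))
    (fun q => Projectivization.mk ℂ (heisVec q) (fun h => one_ne_zero (congrFun h 2)))

/-- `g` is the Heisenberg translation by `a`: on the boundary it is the left translation by `a`
of the Heisenberg group, extended by fixing the point at infinity. -/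
def IsHeisTranslation (g : PU21) (a : Heis) : Prop :=
  g • stereo OnePoint.infty = stereo OnePoint.infty ∧
    ∀ p : Heis, g • stereo (p : OnePoint Heis) = stereo ((a * p : Heis) : OnePoint Heis)

/-! ### The side pairings -/

/-- `ω = e^{-iπ/3}`. -/
def ω : ℂ := Complex.exp (-(Real.pi / 3 : ℝ) * Complex.I)

lemma ω_eq : ω = ⟨1 / 2, -(√3 / 2)⟩ := by
  rw [ω, show (-((Real.pi / 3 : ℝ) : ℂ)) = ((-(Real.pi / 3) : ℝ) : ℂ) by push_cast; ring]
  apply Complex.ext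
  · rw [Complex.exp_ofReal_mul_I_re, Real.cos_neg, Real.cos_pi_div_three]
  · rw [Complex.exp_ofReal_mul_I_im, Real.sin_neg, Real.sin_pi_div_three]

lemma conj_ω : conj ω = 1 - ω := by
  rw [ω_eq]
  apply Complex.ext <;> norm_num [Complex.conj_re, Complex.conj_im]

lemma ω_sq : ω ^ 2 = ω - 1 := by
  have h : √3 * √3 = 3 := Real.mul_self_sqrt (by norm_num)
  rw [ω_eq, pow_two]
  apply Complex.ext
  · simp only [Complex.mul_re, Complex.sub_re, Complex.one_re]
    linarith
  · simp only [Complex.mul_im, Complex.sub_im, Complex.one_im]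
    ring

def G₁Mat : Matrix (Fin 3) (Fin 3) ℂ := !![1, ω, -ω; 0, 1, -conj ω; 0, 0, 1]

def G₂Mat : Matrix (Fin 3) (Fin 3) ℂ := !![1, 1, -ω; -1, 0, -conj ω; -conj ω, ω, 1]

def G₃Mat : Matrix (Fin 3) (Fin 3) ℂ :=
  !![1, 1, -ω; -ω, conj ω, -1 - conj ω; -conj ω, 0, 1 + ω]

/-- The matrix of `[z₁ : z₂ : z₃] ↦ [z₃ : ω̄ z₂ : z₁]`. -/
def κMat : Matrix (Fin 3) (Fin 3) ℂ := !![0, 0, 1; 0, conj ω, 0; 1, 0, 0]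

def G₁ : PU21 := toPU21 G₁Mat (by
  ext i j
  fin_cases i <;> fin_cases j <;>
    simp [G₁Mat, J, Matrix.mul_apply, Fin.sum_univ_three, conj_ω] <;>
    grind [ω_sq])

def G₂ : PU21 := toPU21 G₂Mat (by
  ext i j
  fin_cases i <;> fin_cases j <;>
    simp [G₂Mat, J, Matrix.mul_apply, Fin.sum_univ_three, conj_ω] <;>
    grind [ω_sq])

def G₃ : PU21 := toPU21 G₃Mat (by
  ext i j
  fin_cases i <;> fin_cases j <;>
    simp [G₃Mat, J, Matrix.mul_apply, Fin.sum_univ_three, conj_ω] <;>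
    grind [ω_sq])

/-- The isometry `[z₁ : z₂ : z₃] ↦ [z₃ : ω̄ z₂ : z₁]`, which exchanges `0` and `∞`. -/
def κ : PU21 := toPU21 κMat (by
  ext i j
  fin_cases i <;> fin_cases j <;>
    simp [κMat, J, Matrix.mul_apply, Fin.sum_univ_three, conj_ω] <;>
    grind [ω_sq])

/-! ### The gluing of the two tetrahedra -/

/-- The five ideal points that are the vertices of the two tetrahedra. -/
inductive Vtx
  | p₁ | p₂ | q₁ | q₂ | q₃

/-- The two tetrahedra: `A` has vertices `p₁, p₂, q₁, q₂` and `B` has vertices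
`p₁, p₂, q₂, q₃`. -/
inductive Tet
  | A | B

/-- The four faces after gluing; each is a face of `A` glued to a face of `B`. The face `c` is the
common face of `A` and `B`, the face `gᵢ` is the one glued by the side pairing `Gᵢ`. -/
inductive Face
  | c | g₁ | g₂ | g₃

/-- The other tetrahedron. -/
def Tet.other : Tet → Tet
  | .A => .B
  | .B => .A

/-- The position of the ideal points in the compactified Heisenberg group. -/
def Vtx.pos : Vtx → OnePoint Heis
  | .p₁ => OnePoint.infty
  | .p₂ => ((⟨ω, -√3⟩ : Heis) : OnePoint Heis)
  | .q₁ => ((⟨1, -√3⟩ : Heis) : OnePoint Heis)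
  | .q₂ => ((⟨0, 0⟩ : Heis) : OnePoint Heis)
  | .q₃ => ((⟨-conj ω, √3⟩ : Heis) : OnePoint Heis)

/-- The gluing of the faces of `A` to the faces of `B`, on vertices:
`c : (p₁, p₂, q₂) → (p₁, p₂, q₂)`, `g₁ : (q₂, q₁, p₁) → (q₃, p₂, p₁)`,
`g₂ : (p₂, q₁, q₂) → (p₁, q₂, q₃)`, `g₃ : (q₁, p₂, p₁) → (q₂, p₂, q₃)`. -/
def glue : Face → Vtx → Option Vtx
  | .c, .p₁ => some .p₁
  | .c, .p₂ => some .p₂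
  | .c, .q₂ => some .q₂
  | .g₁, .q₂ => some .q₃
  | .g₁, .q₁ => some .p₂
  | .g₁, .p₁ => some .p₁
  | .g₂, .p₂ => some .p₁
  | .g₂, .q₁ => some .q₂
  | .g₂, .q₂ => some .q₃
  | .g₃, .q₁ => some .q₂
  | .g₃, .p₂ => some .p₂
  | .g₃, .p₁ => some .q₃
  | _, _ => none

/-- The inverse gluing, of the faces of `B` to the faces of `A`. -/
def glueInv : Face → Vtx → Option Vtx
  | .c, .p₁ => some .p₁
  | .c, .p₂ => some .p₂
  | .c, .q₂ => some .q₂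
  | .g₁, .q₃ => some .q₂
  | .g₁, .p₂ => some .q₁
  | .g₁, .p₁ => some .p₁
  | .g₂, .p₁ => some .p₂
  | .g₂, .q₂ => some .q₁
  | .g₂, .q₃ => some .q₂
  | .g₃, .q₂ => some .q₁
  | .g₃, .p₂ => some .p₂
  | .g₃, .q₃ => some .p₁
  | _, _ => none

/-- Leaving the tetrahedron `T` through its face `s`: the vertex `v` of that face becomes the
vertex `cross T s v` of the other tetrahedron; the value is `none` if `v` is not on the face. -/
def cross : Tet → Face → Vtx → Option Vtx
  | .A => glue
  | .B => glueInv

/-- The side pairing, in `PU(2,1)`, of each face (from `A` to `B`). -/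
def Face.pairing : Face → PU21
  | .c => 1
  | .g₁ => G₁
  | .g₂ => G₂
  | .g₃ => G₃

/-! ### The link of the ideal vertex, its fundamental group and the holonomy

The link is a surface made of eight triangles, one for each pair `(T, v)` of a tetrahedron and one
of its vertices. The edges of the triangle `(T, v)` lie on the faces of `T` that contain `v`; its
corners lie on the edges `{v, e}` of `T` that contain `v`. A path in the link is described by the
sequence of the faces that it crosses. -/

/-- The triangle `(T, v)` of the link that is reached from the triangle `x` by crossing the given
faces one after the other (`none` if this is not possible). -/
def walk : Tet × Vtx → List Face → Option (Tet × Vtx)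
  | x, [] => some x
  | x, s :: l => (cross x.1 s x.2).bind fun v => walk (x.1.other, v) l

/-- The same for a path that stays close to one vertex of the link: it starts in the corner on the
edge `{v, e}` of the triangle `(T, v)`, and crosses only faces that contain that edge. -/
def cornerWalk : Tet × Vtx × Vtx → List Face → Option (Tet × Vtx × Vtx)
  | x, [] => some x
  | x, s :: l => (cross x.1 s x.2.1).bind fun v => (cross x.1 s x.2.2).bind fun e =>
      cornerWalk (x.1.other, v, e) l

/-- A closed path at the triangle `x` that only moves around one vertex of the link. -/
def IsCornerLoop (x : Tet × Vtx) (r : List Face) : Prop :=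
  ∃ e : Vtx, e ≠ x.2 ∧ cornerWalk (x.1, x.2, e) r = some (x.1, x.2, e)

/-- The base triangle of the link. -/
def basePt : Tet × Vtx := (.A, .q₂)

/-- Closed paths in the link, at the base triangle. -/
def Loop : Type := {l : List Face // walk basePt l = some basePt}

/-- Elementary homotopy: a closed subpath around one vertex of the link is removed. -/
def ElemHomotopy (a b : Loop) : Prop :=
  ∃ (u r w : List Face) (y : Tet × Vtx), walk basePt u = some y ∧ IsCornerLoop y r ∧
    a.1 = u ++ (r ++ w) ∧ b.1 = u ++ w

/-- The fundamental group of the link: closed paths up to homotopy, that is, modulo the equivalence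
relation generated by the elementary homotopies; the product is concatenation. -/
def LinkGroup : Type := Quot ElemHomotopy

lemma walk_append (x : Tet × Vtx) (u w : List Face) :
    walk x (u ++ w) = (walk x u).bind fun y => walk y w := by
  induction u generalizing x with
  | nil => rfl
  | cons s u ih =>
    simp only [List.cons_append, walk]
    cases cross x.1 s x.2 with
    | none => rfl
    | some v => exact ih _

lemma cornerWalk_append (x : Tet × Vtx × Vtx) (u w : List Face) :
    cornerWalk x (u ++ w) = (cornerWalk x u).bind fun y => cornerWalk y w := by
  induction u generalizing x with
  | nil => rfl
  | cons s u ih =>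
    simp only [List.cons_append, cornerWalk]
    cases cross x.1 s x.2.1 with
    | none => rfl
    | some v =>
      cases cross x.1 s x.2.2 with
      | none => rfl
      | some e => exact ih _

lemma cross_symm {T : Tet} {s : Face} {v v' : Vtx} (h : cross T s v = some v') :
    cross T.other s v' = some v := by
  cases T <;> cases s <;> cases v <;> simp [cross, glue, glueInv] at h <;> subst h <;> rfl

lemma other_other (T : Tet) : T.other.other = T := by cases T <;> rfl

lemma walk_reverse {x y : Tet × Vtx} {l : List Face} (h : walk x l = some y) :
    walk y l.reverse = some x := by
  induction l generalizing x with
  | nil => simpa [walk, eq_comm] using h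
  | cons s l ih =>
    rw [walk, Option.bind_eq_some_iff] at h
    obtain ⟨v, hv, h⟩ := h
    rw [List.reverse_cons, walk_append, ih h]
    simp [walk, cross_symm hv, other_other]

lemma cornerWalk_reverse {x y : Tet × Vtx × Vtx} {l : List Face} (h : cornerWalk x l = some y) :
    cornerWalk y l.reverse = some x := by
  induction l generalizing x with
  | nil => simpa [cornerWalk, eq_comm] using h
  | cons s l ih =>
    rw [cornerWalk, Option.bind_eq_some_iff] at h
    obtain ⟨v, hv, h⟩ := h
    rw [Option.bind_eq_some_iff] at h
    obtain ⟨e, he, h⟩ := h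
    rw [List.reverse_cons, cornerWalk_append, ih h]
    simp [cornerWalk, cross_symm hv, cross_symm he, other_other]

lemma exists_corner {T : Tet} {s : Face} {v v' : Vtx} (h : cross T s v = some v') :
    ∃ e e', e ≠ v ∧ cross T s e = some e' := by
  have key : ∃ e₁ e₂ e₁' e₂', e₁ ≠ e₂ ∧ cross T s e₁ = some e₁' ∧ cross T s e₂ = some e₂' := by
    cases T <;> cases s
    · exact ⟨.p₁, .p₂, _, _, by simp, rfl, rfl⟩
    · exact ⟨.p₁, .q₁, _, _, by simp, rfl, rfl⟩
    · exact ⟨.p₂, .q₁, _, _, by simp, rfl, rfl⟩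
    · exact ⟨.p₁, .p₂, _, _, by simp, rfl, rfl⟩
    · exact ⟨.p₁, .p₂, _, _, by simp, rfl, rfl⟩
    · exact ⟨.p₁, .p₂, _, _, by simp, rfl, rfl⟩
    · exact ⟨.p₁, .q₂, _, _, by simp, rfl, rfl⟩
    · exact ⟨.p₂, .q₂, _, _, by simp, rfl, rfl⟩
  obtain ⟨e₁, e₂, e₁', e₂', hne, h₁, h₂⟩ := key
  by_cases hv : e₁ = v
  · exact ⟨e₂, e₂', fun h => hne (hv.trans h.symm), h₂⟩
  · exact ⟨e₁, e₁', hv, h₁⟩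

namespace Loop

def mul (a b : Loop) : Loop := ⟨a.1 ++ b.1, by rw [walk_append, a.2]; exact b.2⟩

def one : Loop := ⟨[], rfl⟩

def inv (a : Loop) : Loop := ⟨a.1.reverse, walk_reverse a.2⟩

lemma elem_mul_left (a : Loop) {b b' : Loop} (h : ElemHomotopy b b') :
    ElemHomotopy (mul a b) (mul a b') := by
  obtain ⟨u, r, w, y, hu, hr, hb, hb'⟩ := h
  refine ⟨a.1 ++ u, r, w, y, ?_, hr, ?_, ?_⟩
  · rw [walk_append, a.2]; exact hu
  · simp [mul, hb]
  · simp [mul, hb']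

lemma elem_mul_right {a a' : Loop} (b : Loop) (h : ElemHomotopy a a') :
    ElemHomotopy (mul a b) (mul a' b) := by
  obtain ⟨u, r, w, y, hu, hr, ha, ha'⟩ := h
  exact ⟨u, r, w ++ b.1, y, hu, hr, by simp [mul, ha], by simp [mul, ha']⟩

lemma elem_inv {a a' : Loop} (h : ElemHomotopy a a') : ElemHomotopy (inv a) (inv a') := by
  obtain ⟨u, r, w, y, hu, ⟨e, he, hr⟩, ha, ha'⟩ := h
  refine ⟨w.reverse, r.reverse, u.reverse, y, ?_, ⟨e, he, cornerWalk_reverse hr⟩, ?_, ?_⟩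
  · have h := a'.2
    rw [ha', walk_append, hu] at h
    exact walk_reverse h
  · simp [inv, ha]
  · simp [inv, ha']

lemma mk_path_reverse (l : List Face) :
    ∀ {y : Tet × Vtx}, walk basePt l = some y → ∀ h : walk basePt (l ++ l.reverse) = some basePt,
      Quot.mk ElemHomotopy ⟨l ++ l.reverse, h⟩ = Quot.mk ElemHomotopy one := by
  induction l using List.reverseRecOn with
  | nil => intros; rfl
  | append_singleton l s ih =>
    intro y hy h
    rw [walk_append, Option.bind_eq_some_iff] at hy
    obtain ⟨x, hx, hs⟩ := hy
    have hl : walk basePt (l ++ l.reverse) = some basePt := by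
      rw [walk_append, hx]; exact walk_reverse hx
    rw [← ih hx hl]
    apply Quot.sound
    refine ⟨l, [s, s], l.reverse, x, hx, ?_, by simp, rfl⟩
    rw [walk, Option.bind_eq_some_iff] at hs
    obtain ⟨v, hv, -⟩ := hs
    obtain ⟨e, e', hne, he⟩ := exists_corner hv
    exact ⟨e, hne, by simp [cornerWalk, hv, he, cross_symm hv, cross_symm he, other_other]⟩

end Loop

namespace LinkGroup

/-- The class of a closed path. -/
def mk (a : Loop) : LinkGroup := Quot.mk _ a

instance : Mul LinkGroup :=
  ⟨Quot.map₂ Loop.mul (fun a _ _ h => Loop.elem_mul_left a h)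
    (fun _ _ b h => Loop.elem_mul_right b h)⟩

instance : One LinkGroup := ⟨mk Loop.one⟩

instance : Inv LinkGroup := ⟨Quot.map Loop.inv (fun _ _ h => Loop.elem_inv h)⟩

instance : Group LinkGroup :=
  Group.ofLeftAxioms
    (by
      rintro ⟨a⟩ ⟨b⟩ ⟨c⟩
      exact congrArg (Quot.mk _) (Subtype.ext (List.append_assoc _ _ _)))
    (by
      rintro ⟨a⟩
      rfl)
    (by
      rintro ⟨a⟩
      have h := Loop.mk_path_reverse a.1.reverse (Loop.inv a).2
        (by rw [List.reverse_reverse]; exact (Loop.mul (Loop.inv a) a).2)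
      refine Eq.trans ?_ h
      exact congrArg (Quot.mk _) (Subtype.ext (by simp [Loop.mul, Loop.inv])))

end LinkGroup

/-- The holonomy along a path that starts in `T`. The tetrahedra are developed one after the other:
if the current copy is `h • T`, then the next one across the face `s` is `h • Gₛ⁻¹ • B` if `T = A`,
and `h • Gₛ • A` if `T = B`. -/
def pathHolonomy : Tet → List Face → PU21
  | _, [] => 1
  | .A, s :: l => s.pairing⁻¹ * pathHolonomy .B l
  | .B, s :: l => s.pairing * pathHolonomy .A l

/-- The holonomy of a closed path at the base triangle. -/
def Loop.holonomy (a : Loop) : PU21 := pathHolonomy basePt.1 a.1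

def H₁ : PU21 := G₁⁻¹ * G₃ * G₁⁻¹ * G₂ * G₃⁻¹ * G₁ * G₃⁻¹

def H₂ : PU21 := G₂⁻¹ * G₁

/-- The subgroup of the Heisenberg group generated by `[2ω, 2√3]` and `[-ω, √3]`. -/
def translationLattice : Subgroup Heis :=
  Subgroup.closure {⟨2 * ω, 2 * √3⟩, ⟨-ω, √3⟩}

end FigEight

end

/-!
The developed link is uniformized by an explicit lattice. The argument has three independent inputs.

* In `PU(2,1)`, the three side pairings satisfy the two relations `G₁ G₂ = G₂ G₃` and
  `G₁ G₃⁻¹ G₂ = G₃⁻¹ G₁`, one for each edge of the glued complex. They say that the copies of the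
  tetrahedra around an edge close up, so the crossing of a face `s` next to an edge is the quotient
  of the values of a function on the corners of the link (`develop`). Hence the holonomy around a
  vertex of the link is trivial (`IsCornerLoop.pathHolonomy_eq_one`) and the holonomy descends to
  the fundamental group (`holonomyHom`). Identities in `PU(2,1)` are checked on matrices with
  entries in `ℤ[ω]`, by `ω ^ 2 = ω - 1`.

* The eight triangles of the link form a ring: the word of `H₁` crosses each of them once. Without
  its last edge this ring is a spanning tree of the dual graph. Of the five remaining dual edges, one
  closes the ring (`ringClass`, with holonomy `H₁`), and three of the four vertex relations of the
  torus identify the other four with one another (`stepClass`, with holonomy `H₂`). The fourth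
  relation says that the two classes commute. So the fundamental group is a quotient of `ℤ²`
  (`linkHom_surjective`).

* Conjugation by `κ` turns `H₁` and `H₂` into the Heisenberg translations by `[2ω, 2√3]` and
  `[-ω, √3]`. These generate a copy of `ℤ²` with the integral coordinates `2m - n` and `2m + n`
  (`zpowPairHom_trans`), hence a discrete subgroup. A nontrivial Heisenberg translation is a unipotent
  matrix that fixes no point of the closed hyperbolic plane other than infinity
  (`isParabolic_heisTrans`).

Thus a nontrivial class of the link has nontrivial exponents, its holonomy is conjugate to a
nontrivial translation, and that is parabolic; as the identity is not parabolic, the holonomy is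
faithful.
-/

noncomputable section

namespace FigEight

/-! ### Computing in `PU(2,1)` -/

lemma toPU21_mul {M N : Matrix (Fin 3) (Fin 3) ℂ} (hM : Mᴴ * J * M = J) (hN : Nᴴ * J * N = J)
    (hMN : (M * N)ᴴ * J * (M * N) = J) :
    toPU21 M hM * toPU21 N hN = toPU21 (M * N) hMN := by
  apply Subtype.ext
  change Matrix.ProjGenLinGroup.mk _ * Matrix.ProjGenLinGroup.mk _ = Matrix.ProjGenLinGroup.mk _
  rw [← map_mul]
  congr 1
  apply Units.ext
  rfl

lemma conjTranspose_mul_J_mul {M N : Matrix (Fin 3) (Fin 3) ℂ} (hM : Mᴴ * J * M = J)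
    (hN : Nᴴ * J * N = J) : (M * N)ᴴ * J * (M * N) = J := by
  calc (M * N)ᴴ * J * (M * N) = Nᴴ * (Mᴴ * J * M) * N := by
        simp only [Matrix.conjTranspose_mul, Matrix.mul_assoc]
    _ = J := by rw [hM, hN]

/-- Matrices that differ by a scalar define the same element of `PU(2,1)`. -/
lemma toPU21_eq_of_smul {M N : Matrix (Fin 3) (Fin 3) ℂ} (hM : Mᴴ * J * M = J)
    (hN : Nᴴ * J * N = J) {c : ℂ} (hc : c ≠ 0) (h : M = c • N) :
    toPU21 M hM = toPU21 N hN := by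
  apply Subtype.ext
  change Matrix.ProjGenLinGroup.mk _ = Matrix.ProjGenLinGroup.mk _
  rw [eq_comm, Matrix.ProjGenLinGroup.mk_eq_mk_iff]
  refine ⟨Units.mk0 c hc, Units.ext ?_⟩
  change N * Matrix.scalar (Fin 3) c = M
  rw [h, Matrix.scalar_apply, ← Matrix.smul_eq_mul_diagonal]

lemma toPU21_mul_eq_one {M N : Matrix (Fin 3) (Fin 3) ℂ} (hM : Mᴴ * J * M = J)
    (hN : Nᴴ * J * N = J) (h : M * N = 1) : toPU21 M hM * toPU21 N hN = 1 := by
  rw [toPU21_mul hM hN (conjTranspose_mul_J_mul hM hN)]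
  apply Subtype.ext
  change Matrix.ProjGenLinGroup.mk _ = 1
  rw [← map_one Matrix.ProjGenLinGroup.mk]
  congr 1
  exact Units.ext h

lemma mulVec_ne_zero {M : Matrix (Fin 3) (Fin 3) ℂ} (hM : Mᴴ * J * M = J) {v : Fin 3 → ℂ}
    (hv : v ≠ 0) : M *ᵥ v ≠ 0 := fun h =>
  (smul_ne_zero_iff_ne (toU21 M hM : GL (Fin 3) ℂ)).2 hv h

lemma toPU21_smul_mk {M : Matrix (Fin 3) (Fin 3) ℂ} (hM : Mᴴ * J * M = J) {v : Fin 3 → ℂ}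
    (hv : v ≠ 0) : toPU21 M hM • (Projectivization.mk ℂ v hv : CP2) =
      Projectivization.mk ℂ (M *ᵥ v) (mulVec_ne_zero hM hv) := rfl

lemma toPU21_smul_mk_eq_iff {M : Matrix (Fin 3) (Fin 3) ℂ} (hM : Mᴴ * J * M = J)
    {v w : Fin 3 → ℂ} (hv : v ≠ 0) (hw : w ≠ 0) :
    toPU21 M hM • (Projectivization.mk ℂ v hv : CP2) = Projectivization.mk ℂ w hw ↔
      ∃ c : ℂ, c • w = M *ᵥ v := by
  rw [toPU21_smul_mk, Projectivization.mk_eq_mk_iff']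

lemma exists_toPU21 (g : PU21) : ∃ M, ∃ hM : Mᴴ * J * M = J, g = toPU21 M hM := by
  obtain ⟨_, u, hu, rfl⟩ := g
  refine ⟨(u : Matrix (Fin 3) (Fin 3) ℂ), hu, Subtype.ext ?_⟩
  change Matrix.ProjGenLinGroup.mk _ = Matrix.ProjGenLinGroup.mk _
  congr 1
  exact Units.ext rfl

/-! ### The action on the complex hyperbolic plane and on its boundary -/

lemma herm_smul (c : ℂ) (v : Fin 3 → ℂ) :
    herm (c • v) (c • v) = ((Complex.normSq c : ℝ) : ℂ) * herm v v := by
  simp only [herm, Pi.smul_apply, smul_eq_mul, map_mul, ← Complex.mul_conj]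
  ring

lemma herm_mulVec {M : Matrix (Fin 3) (Fin 3) ℂ} (hM : Mᴴ * J * M = J) (v : Fin 3 → ℂ) :
    herm (M *ᵥ v) (M *ᵥ v) = herm v v := by
  have key : ∀ w : Fin 3 → ℂ, herm w w = star w ⬝ᵥ (J *ᵥ w) := by
    intro w
    simp [herm, J, Matrix.mulVec, dotProduct, Fin.sum_univ_three]
    ring
  rw [key, key, Matrix.star_mulVec, ← Matrix.dotProduct_mulVec, Matrix.mulVec_mulVec,
    Matrix.mulVec_mulVec, hM]

lemma mk_mem_hyperbolicPlane_iff {v : Fin 3 → ℂ} (hv : v ≠ 0) :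
    (Projectivization.mk ℂ v hv : CP2) ∈ hyperbolicPlane ↔ (herm v v).re < 0 := by
  obtain ⟨a, ha⟩ := Projectivization.exists_smul_eq_mk_rep ℂ v hv
  have h : 0 < Complex.normSq (a : ℂ) := Complex.normSq_pos.2 a.ne_zero
  rw [hyperbolicPlane, Set.mem_ofPred_eq, ← ha, Units.smul_def, herm_smul, Complex.re_ofReal_mul]
  exact ⟨fun h' => neg_of_mul_neg_right h' h.le, fun h' => mul_neg_of_pos_of_neg h h'⟩

lemma mk_mem_hyperbolicBoundary_iff {v : Fin 3 → ℂ} (hv : v ≠ 0) :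
    (Projectivization.mk ℂ v hv : CP2) ∈ hyperbolicBoundary ↔ herm v v = 0 := by
  obtain ⟨a, ha⟩ := Projectivization.exists_smul_eq_mk_rep ℂ v hv
  have h : Complex.normSq (a : ℂ) ≠ 0 := (Complex.normSq_pos.2 a.ne_zero).ne'
  rw [hyperbolicBoundary, Set.mem_ofPred_eq, ← ha, Units.smul_def, herm_smul, mul_eq_zero,
    Complex.ofReal_eq_zero, or_iff_right h]

lemma smul_mem_hyperbolicPlane_iff (g : PU21) (x : CP2) :
    g • x ∈ hyperbolicPlane ↔ x ∈ hyperbolicPlane := by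
  obtain ⟨M, hM, rfl⟩ := exists_toPU21 g
  induction x using Projectivization.ind with | _ v hv
  rw [toPU21_smul_mk, mk_mem_hyperbolicPlane_iff, mk_mem_hyperbolicPlane_iff, herm_mulVec hM]

lemma smul_mem_hyperbolicBoundary_iff (g : PU21) (x : CP2) :
    g • x ∈ hyperbolicBoundary ↔ x ∈ hyperbolicBoundary := by
  obtain ⟨M, hM, rfl⟩ := exists_toPU21 g
  induction x using Projectivization.ind with | _ v hv
  rw [toPU21_smul_mk, mk_mem_hyperbolicBoundary_iff, mk_mem_hyperbolicBoundary_iff, herm_mulVec hM]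

lemma IsParabolic.conj {g : PU21} (hg : IsParabolic g) (k : PU21) :
    IsParabolic (k * g * k⁻¹) := by
  have key : ∀ x : CP2, (k * g * k⁻¹) • x = x ↔ g • (k⁻¹ • x) = k⁻¹ • x := by
    intro x
    rw [mul_smul, mul_smul, ← eq_inv_smul_iff (g := k)]
  obtain ⟨h1, y, ⟨hy, hgy⟩, huniq⟩ := hg
  refine ⟨fun x hx h => h1 _ ((smul_mem_hyperbolicPlane_iff k⁻¹ x).2 hx) ((key x).1 h),
    k • y, ⟨(smul_mem_hyperbolicBoundary_iff k y).2 hy, ?_⟩, ?_⟩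
  · rw [key, inv_smul_smul, hgy]
  · rintro x ⟨hx, hgx⟩
    rw [← huniq (k⁻¹ • x) ⟨(smul_mem_hyperbolicBoundary_iff k⁻¹ x).2 hx, (key x).1 hgx⟩,
      smul_inv_smul]

/-! ### Heisenberg translations -/

namespace Heis

@[simp] lemma mul_z (a b : Heis) : (a * b).z = a.z + b.z := rfl
@[simp] lemma mul_t (a b : Heis) : (a * b).t = a.t + b.t + 2 * (a.z * conj b.z).im := rfl

end Heis

/-- The unipotent matrix of the Heisenberg translation by `a`. -/
def heisMat (a : Heis) : Matrix (Fin 3) (Fin 3) ℂ :=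
  !![1, -conj a.z, (-(a.z * conj a.z) + Complex.I * a.t) / 2; 0, 1, a.z; 0, 0, 1]

lemma two_I_mul_im_mul_conj (z w : ℂ) :
    2 * Complex.I * ((z * conj w).im : ℂ) = z * conj w - conj z * w := by
  have h := Complex.sub_conj (z * conj w)
  rw [map_mul, Complex.conj_conj] at h
  rw [h]
  push_cast
  ring

lemma heisMat_mul (a b : Heis) : heisMat a * heisMat b = heisMat (a * b) := by
  have h := two_I_mul_im_mul_conj a.z b.z
  ext i j
  fin_cases i <;> fin_cases j <;>
    simp [heisMat, Matrix.mul_apply, Fin.sum_univ_three, -Complex.mul_im] <;> grind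

lemma heisMat_unitary (a : Heis) : (heisMat a)ᴴ * J * heisMat a = J := by
  ext i j
  fin_cases i <;> fin_cases j <;>
    simp [heisMat, J, Matrix.mul_apply, Fin.sum_univ_three, map_ofNat] <;> grind

/-- The Heisenberg group acts on `CP²` by Heisenberg translations. -/
def heisTrans : Heis →* PU21 where
  toFun a := toPU21 (heisMat a) (heisMat_unitary a)
  map_one' := by
    rw [← mul_eq_left (a := toPU21 (heisMat 1) (heisMat_unitary 1)),
      toPU21_mul _ _ (conjTranspose_mul_J_mul (heisMat_unitary 1) (heisMat_unitary 1))]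
    simp only [heisMat_mul, mul_one]
  map_mul' a b := by
    rw [toPU21_mul _ _ (conjTranspose_mul_J_mul (heisMat_unitary a) (heisMat_unitary b))]
    simp only [heisMat_mul]

lemma heisMat_mulVec_heisVec (a p : Heis) : heisMat a *ᵥ heisVec p = heisVec (a * p) := by
  have h := two_I_mul_im_mul_conj a.z p.z
  have e : ∀ z : ℂ, (‖z‖ : ℂ) ^ 2 = z * conj z := fun z => (Complex.mul_conj' z).symm
  ext i
  fin_cases i <;>
    simp [heisMat, heisVec, Matrix.mulVec, dotProduct, Fin.sum_univ_three, e, -Complex.mul_im] <;>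
    grind

lemma isHeisTranslation_heisTrans (a : Heis) : IsHeisTranslation (heisTrans a) a := by
  constructor
  · refine (toPU21_smul_mk_eq_iff (heisMat_unitary a) _ _).2 ⟨1, ?_⟩
    ext i
    fin_cases i <;> simp [heisMat, Matrix.mulVec, dotProduct, Fin.sum_univ_three]
  · intro p
    refine (toPU21_smul_mk_eq_iff (heisMat_unitary a) _ _).2 ⟨1, ?_⟩
    rw [one_smul, heisMat_mulVec_heisVec]

/-- The fixed points of a nontrivial Heisenberg translation are on the line `z₃ = 0`, which meets the
closure of the hyperbolic plane in the point at infinity only. -/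
lemma isParabolic_heisTrans {a : Heis} (ha : a ≠ 1) : IsParabolic (heisTrans a) := by
  have hfix : ∀ {v : Fin 3 → ℂ} (hv : v ≠ 0),
      heisTrans a • (Projectivization.mk ℂ v hv : CP2) = Projectivization.mk ℂ v hv → v 2 = 0 := by
    intro v hv h
    obtain ⟨c, hc⟩ := (toPU21_smul_mk_eq_iff (heisMat_unitary a) hv hv).1 h
    by_contra h2
    have e2 := congrFun hc 2
    have e1 := congrFun hc 1
    have e0 := congrFun hc 0
    simp [heisMat, Matrix.mulVec, dotProduct, Fin.sum_univ_three, h2] at e0 e1 e2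
    subst e2
    have hz : a.z = 0 := by simpa [h2] using e1
    have ht : a.t = 0 := by simpa [h2, hz] using e0
    exact ha (Heis.ext hz ht)
  have hherm : ∀ {v : Fin 3 → ℂ}, v 2 = 0 → herm v v = ((Complex.normSq (v 1) : ℝ) : ℂ) := by
    intro v h
    simp [herm, h, Complex.mul_conj]
  refine ⟨?_, stereo OnePoint.infty, ⟨?_, (isHeisTranslation_heisTrans a).1⟩, ?_⟩
  · intro x
    induction x using Projectivization.ind with | _ v hv
    intro hx h
    rw [mk_mem_hyperbolicPlane_iff, hherm (hfix hv h), Complex.ofReal_re] at hx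
    exact absurd hx (not_lt.2 (Complex.normSq_nonneg _))
  · exact (mk_mem_hyperbolicBoundary_iff _).2 (by simp [herm])
  · intro x
    induction x using Projectivization.ind with | _ v hv
    rintro ⟨hx, h⟩
    rw [mk_mem_hyperbolicBoundary_iff, hherm (hfix hv h), Complex.ofReal_eq_zero,
      Complex.normSq_eq_zero] at hx
    refine (Projectivization.mk_eq_mk_iff' ℂ _ _ _ _).2 ⟨v 0, ?_⟩
    ext i
    fin_cases i <;> simp [hx, hfix hv h]

lemma not_isParabolic_one : ¬ IsParabolic 1 := by
  rintro ⟨h, -⟩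
  have hv : (![-1, 0, 1] : Fin 3 → ℂ) ≠ 0 := fun h => one_ne_zero (congrFun h 2)
  refine h (Projectivization.mk ℂ _ hv) ((mk_mem_hyperbolicPlane_iff hv).2 ?_) (one_smul _ _)
  simp [herm, show (![-1, 0, 1] : Fin 3 → ℂ) 2 = 1 from rfl]

/-! ### The side pairings on the vertices -/

lemma I_mul_sqrt_three : Complex.I * (√3 : ℂ) = 1 - 2 * ω := by
  rw [ω_eq]
  apply Complex.ext <;> simp
  ring

lemma norm_ω : ‖ω‖ = 1 := by
  rw [ω]
  exact_mod_cast Complex.norm_exp_ofReal_mul_I (-(Real.pi / 3))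

lemma ω_ne_zero : ω ≠ 0 := norm_ne_zero_iff.1 (by rw [norm_ω]; exact one_ne_zero)

/-- Null vectors with entries in `ℤ[ω]` that represent the five ideal vertices. -/
def Vtx.vec : Vtx → Fin 3 → ℂ
  | .p₁ => ![1, 0, 0]
  | .p₂ => ![ω - 1, ω, 1]
  | .q₁ => ![ω - 1, 1, 1]
  | .q₂ => ![0, 0, 1]
  | .q₃ => ![-ω, ω - 1, 1]

lemma Vtx.vec_ne_zero (v : Vtx) : v.vec ≠ 0 := by
  intro h
  cases v
  · exact one_ne_zero (congrFun h 0)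
  all_goals exact one_ne_zero (congrFun h 2)

lemma stereo_pos (v : Vtx) : stereo v.pos = Projectivization.mk ℂ v.vec v.vec_ne_zero := by
  have h := I_mul_sqrt_three
  cases v
  case p₁ => rfl
  all_goals
    refine (Projectivization.mk_eq_mk_iff' ℂ _ _ _ _).2 ⟨1, ?_⟩
    ext i
    fin_cases i <;> simp [Vtx.vec, heisVec, norm_ω, conj_ω]
  · grind
  · grind
  · have e : ‖ω - 1‖ = 1 := by
      rw [← ω_sq, norm_pow, norm_ω, one_pow]
    rw [← neg_sub, norm_neg, norm_sub_rev, e, Complex.ofReal_one]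
    grind

/-- On the chosen null vectors the matrices of the side pairings act up to the units `1` and `ω ^ 2`
of `ℤ[ω]`. -/
lemma pairing_smul_stereo (s : Face) (v v' : Vtx) (h : cross .A s v = some v') :
    s.pairing • stereo v.pos = stereo v'.pos := by
  have h2 := ω_sq
  rw [stereo_pos, stereo_pos]
  cases s
  case c => cases v <;> simp [cross, glue] at h <;> subst h <;> exact one_smul _ _
  case g₁ =>
    refine (toPU21_smul_mk_eq_iff _ _ _).2 ⟨1, ?_⟩
    cases v <;> simp [cross, glue] at h <;> subst h <;> ext i <;> fin_cases i <;>
      simp [Vtx.vec, G₁Mat, Matrix.mulVec, dotProduct, Fin.sum_univ_three, conj_ω]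
  case g₂ =>
    refine (toPU21_smul_mk_eq_iff _ _ _).2 ?_
    cases v <;> simp [cross, glue] at h <;> subst h
    · refine ⟨ω ^ 2, ?_⟩
      ext i
      fin_cases i <;>
        simp [Vtx.vec, G₂Mat, Matrix.mulVec, dotProduct, Fin.sum_univ_three, conj_ω] <;> grind
    all_goals
      refine ⟨1, ?_⟩
      ext i
      fin_cases i <;>
        simp [Vtx.vec, G₂Mat, Matrix.mulVec, dotProduct, Fin.sum_univ_three, conj_ω] <;> grind
  case g₃ =>
    refine (toPU21_smul_mk_eq_iff _ _ _).2 ?_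
    cases v <;> simp [cross, glue] at h <;> subst h
    · refine ⟨ω ^ 2, ?_⟩
      ext i
      fin_cases i <;>
        simp [Vtx.vec, G₃Mat, Matrix.mulVec, dotProduct, Fin.sum_univ_three, conj_ω] <;> grind
    all_goals
      refine ⟨1, ?_⟩
      ext i
      fin_cases i <;>
        simp [Vtx.vec, G₃Mat, Matrix.mulVec, dotProduct, Fin.sum_univ_three, conj_ω] <;> grind

lemma κ_smul_stereo_q₂ : κ • stereo Vtx.q₂.pos = stereo OnePoint.infty := by
  rw [stereo_pos]
  refine (toPU21_smul_mk_eq_iff _ _ _).2 ⟨1, ?_⟩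
  ext i
  fin_cases i <;> simp [Vtx.vec, κMat, Matrix.mulVec, dotProduct, Fin.sum_univ_three]

/-! ### Relations between the side pairings -/

/-- The matrix `M` preserves the Hermitian form, and its class in `PU(2,1)` is `g`. The matrix is
determined by `g` up to a scalar of modulus one. -/
def Represents (M : Matrix (Fin 3) (Fin 3) ℂ) (g : PU21) : Prop :=
  ∃ hM : Mᴴ * J * M = J, toPU21 M hM = g

namespace Represents

variable {M N P : Matrix (Fin 3) (Fin 3) ℂ} {g h : PU21}

lemma mul (hg : Represents M g) (hh : Represents N h) (hP : M * N = P) :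
    Represents P (g * h) := by
  obtain ⟨hM, rfl⟩ := hg
  obtain ⟨hN, rfl⟩ := hh
  subst hP
  exact ⟨conjTranspose_mul_J_mul hM hN, (toPU21_mul hM hN _).symm⟩

lemma inv (hg : Represents M g) (hP : P * M = 1) : Represents P g⁻¹ := by
  obtain ⟨hM, rfl⟩ := hg
  have hN : Pᴴ * J * P = J := by
    calc Pᴴ * J * P = Pᴴ * (Mᴴ * J * M) * P := by rw [hM]
      _ = (M * P)ᴴ * J * (M * P) := by simp only [Matrix.conjTranspose_mul, Matrix.mul_assoc]
      _ = J := by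
        rw [mul_eq_one_comm.1 hP, Matrix.conjTranspose_one, Matrix.one_mul, Matrix.mul_one]
  exact ⟨hN, eq_inv_of_mul_eq_one_left (toPU21_mul_eq_one hN hM hP)⟩

lemma eq_of_smul (hg : Represents M g) (hh : Represents N h) {c : ℂ} (hc : c ≠ 0)
    (e : M = c • N) : g = h := by
  obtain ⟨hM, rfl⟩ := hg
  obtain ⟨hN, rfl⟩ := hh
  exact toPU21_eq_of_smul hM hN hc e

lemma eq (hg : Represents M g) (hh : Represents M h) : g = h :=
  hg.eq_of_smul hh one_ne_zero (one_smul ℂ M).symm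

end Represents

lemma represents_G₁ : Represents !![1, ω, -ω; 0, 1, -1 + ω; 0, 0, 1] G₁ := by
  have h : G₁Mat = !![1, ω, -ω; 0, 1, -1 + ω; 0, 0, 1] := by
    rw [G₁Mat, conj_ω, neg_sub']; ring_nf
  exact h ▸ ⟨_, rfl⟩

lemma represents_G₂ : Represents !![1, 1, -ω; -1, 0, -1 + ω; -1 + ω, ω, 1] G₂ := by
  have h : G₂Mat = !![1, 1, -ω; -1, 0, -1 + ω; -1 + ω, ω, 1] := by
    rw [G₂Mat, conj_ω]; ring_nf
  exact h ▸ ⟨_, rfl⟩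

lemma represents_G₃ :
    Represents !![1, 1, -ω; -ω, 1 - ω, -2 + ω; -1 + ω, 0, 1 + ω] G₃ := by
  have h : G₃Mat = !![1, 1, -ω; -ω, 1 - ω, -2 + ω; -1 + ω, 0, 1 + ω] := by
    rw [G₃Mat, conj_ω]; ring_nf
  exact h ▸ ⟨_, rfl⟩

lemma represents_κ : Represents !![0, 0, 1; 0, 1 - ω, 0; 1, 0, 0] κ := by
  have h : κMat = !![0, 0, 1; 0, 1 - ω, 0; 1, 0, 0] := by
    rw [κMat, conj_ω]
  exact h ▸ ⟨_, rfl⟩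

lemma represents_G₁_inv :
    Represents !![1, -ω, -1 + ω; 0, 1, 1 - ω; 0, 0, 1] G₁⁻¹ := by
  have h2 := ω_sq
  refine represents_G₁.inv ?_
  ext i j
  fin_cases i <;> fin_cases j <;>
    simp [Matrix.mul_apply, Fin.sum_univ_three] <;> grind

lemma represents_G₂_inv :
    Represents !![1, -ω, -1 + ω; 1 - ω, 0, 1; -ω, -1, 1] G₂⁻¹ := by
  have h2 := ω_sq
  refine represents_G₂.inv ?_
  ext i j
  fin_cases i <;> fin_cases j <;>
    simp [Matrix.mul_apply, Fin.sum_univ_three] <;> grind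

lemma represents_G₃_inv :
    Represents !![2 - ω, -1 - ω, -1 + ω; 0, ω, 1; -ω, -1 + ω, 1] G₃⁻¹ := by
  have h2 := ω_sq
  refine represents_G₃.inv ?_
  ext i j
  fin_cases i <;> fin_cases j <;>
    simp [Matrix.mul_apply, Fin.sum_univ_three] <;> grind

/-- The cycle relation of the edge class of `p₁q₂`. -/
lemma G₁_mul_G₂ : G₁ * G₂ = G₂ * G₃ := by
  have h2 := ω_sq
  refine (represents_G₁.mul represents_G₂ rfl).eq (represents_G₂.mul represents_G₃ ?_)
  ext i j
  fin_cases i <;> fin_cases j <;> simp [Matrix.mul_apply, Fin.sum_univ_three] <;> grind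

lemma represents_G₁_mul_G₃_inv :
    Represents !![1, -1, -1 + ω; 1, 0, ω; -ω, -1 + ω, 1] (G₁ * G₃⁻¹) := by
  have h2 := ω_sq
  refine represents_G₁.mul represents_G₃_inv ?_
  ext i j
  fin_cases i <;> fin_cases j <;> simp [Matrix.mul_apply, Fin.sum_univ_three] <;> grind

lemma represents_G₁_inv_mul_G₃ :
    Represents !![0, 0, -1 + ω; 0, 1 - ω, 0; -1 + ω, 0, 1 + ω] (G₁⁻¹ * G₃) := by
  have h2 := ω_sq
  refine represents_G₁_inv.mul represents_G₃ ?_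
  ext i j
  fin_cases i <;> fin_cases j <;> simp [Matrix.mul_apply, Fin.sum_univ_three] <;> grind

/-- The cycle relation of the edge class of `p₁p₂`. -/
lemma G₁_mul_G₃_inv_mul_G₂ : G₁ * G₃⁻¹ * G₂ = G₃⁻¹ * G₁ := by
  have h2 := ω_sq
  refine (represents_G₁_mul_G₃_inv.mul represents_G₂ rfl).eq
    (represents_G₃_inv.mul represents_G₁ ?_)
  ext i j
  fin_cases i <;> fin_cases j <;> simp [Matrix.mul_apply, Fin.sum_univ_three] <;> grind

lemma represents_G₁_inv_mul_G₂ :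
    Represents !![1, 0, 0; -1 + ω, 1, 0; -1 + ω, ω, 1] (G₁⁻¹ * G₂) := by
  have h2 := ω_sq
  refine represents_G₁_inv.mul represents_G₂ ?_
  ext i j
  fin_cases i <;> fin_cases j <;> simp [Matrix.mul_apply, Fin.sum_univ_three] <;> grind

lemma represents_G₁_inv_mul_G₂_mul_G₃_inv :
    Represents !![2 - ω, -1 - ω, -1 + ω; -1 + 2 * ω, 2, 1 - ω; -1 + ω, ω, 1]
      (G₁⁻¹ * G₂ * G₃⁻¹) := by
  have h2 := ω_sq
  refine represents_G₁_inv_mul_G₂.mul represents_G₃_inv ?_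
  ext i j
  fin_cases i <;> fin_cases j <;> simp [Matrix.mul_apply, Fin.sum_univ_three] <;> grind

lemma represents_H₁_mul_G₃_mul_G₁_inv :
    Represents !![-ω, -1, -1 + ω; 1 + ω, 2 - 2 * ω, -ω; -3 + 3 * ω, 1 + ω, 1]
      (G₁⁻¹ * G₃ * (G₁⁻¹ * G₂ * G₃⁻¹)) := by
  have h2 := ω_sq
  refine represents_G₁_inv_mul_G₃.mul represents_G₁_inv_mul_G₂_mul_G₃_inv ?_
  ext i j
  fin_cases i <;> fin_cases j <;> simp [Matrix.mul_apply, Fin.sum_univ_three] <;> grind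

lemma H₁_eq : H₁ = G₁⁻¹ * G₃ * (G₁⁻¹ * G₂ * G₃⁻¹) * (G₁ * G₃⁻¹) := by
  rw [H₁]
  simp only [mul_assoc]

lemma represents_H₁ :
    Represents !![-ω, 0, 0; 2, -ω, 0; -2 + 3 * ω, 2 - 2 * ω, -ω] H₁ := by
  have h2 := ω_sq
  rw [H₁_eq]
  refine represents_H₁_mul_G₃_mul_G₁_inv.mul represents_G₁_mul_G₃_inv ?_
  ext i j
  fin_cases i <;> fin_cases j <;> simp [Matrix.mul_apply, Fin.sum_univ_three] <;> grind

lemma represents_H₂ : Represents !![1, 0, 0; 1 - ω, 1, 0; -ω, -ω, 1] H₂ := by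
  have h2 := ω_sq
  refine represents_G₂_inv.mul represents_G₁ ?_
  ext i j
  fin_cases i <;> fin_cases j <;> simp [Matrix.mul_apply, Fin.sum_univ_three] <;> grind

/-- The generator `[2ω, 2√3]` of the translation lattice. -/
def longTrans : Heis := ⟨2 * ω, 2 * √3⟩

/-- The generator `[-ω, √3]` of the translation lattice. -/
def shortTrans : Heis := ⟨-ω, √3⟩

lemma represents_longTrans :
    Represents !![1, -2 + 2 * ω, -1 - 2 * ω; 0, 1, 2 * ω; 0, 0, 1] (heisTrans longTrans) := by
  have h2 := ω_sq
  have hI := I_mul_sqrt_three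
  have h : heisMat longTrans = !![1, -2 + 2 * ω, -1 - 2 * ω; 0, 1, 2 * ω; 0, 0, 1] := by
    ext i j
    fin_cases i <;> fin_cases j <;> simp [heisMat, longTrans, conj_ω, map_ofNat] <;> grind
  exact h ▸ ⟨_, rfl⟩

lemma represents_shortTrans :
    Represents !![1, 1 - ω, -ω; 0, 1, -ω; 0, 0, 1] (heisTrans shortTrans) := by
  have h2 := ω_sq
  have hI := I_mul_sqrt_three
  have h : heisMat shortTrans = !![1, 1 - ω, -ω; 0, 1, -ω; 0, 0, 1] := by
    ext i j
    fin_cases i <;> fin_cases j <;> simp [heisMat, shortTrans, conj_ω]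
    grind
  exact h ▸ ⟨_, rfl⟩

lemma κ_conj_H₁ : κ * H₁ * κ⁻¹ = heisTrans longTrans := by
  have h2 := ω_sq
  rw [mul_inv_eq_iff_eq_mul]
  refine (represents_κ.mul represents_H₁ rfl).eq_of_smul
    (represents_longTrans.mul represents_κ rfl) (neg_ne_zero.2 ω_ne_zero) ?_
  ext i j
  fin_cases i <;> fin_cases j <;> simp [Matrix.mul_apply, Fin.sum_univ_three] <;> grind

lemma κ_conj_H₂ : κ * H₂ * κ⁻¹ = heisTrans shortTrans := by
  have h2 := ω_sq
  rw [mul_inv_eq_iff_eq_mul]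
  refine (represents_κ.mul represents_H₂ rfl).eq (represents_shortTrans.mul represents_κ ?_)
  ext i j
  fin_cases i <;> fin_cases j <;> simp [Matrix.mul_apply, Fin.sum_univ_three] <;> grind

/-! ### Well-definedness of the holonomy -/

/-- The tetrahedra developed around an edge. There are two classes of edges, with representatives
`p₁p₂` and `p₁q₂` of `A`; going around the representative, starting with `A` itself, one meets the
copy `develop T v e • T` of each tetrahedron `T` with an edge `{v, e}` of this class. The value is `1`
for the two representatives and for the same edges of `B`, and (without meaning) where `{v, e}` is
not an edge of `T`. -/
def develop : Tet → Vtx → Vtx → PU21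
  | .A, .p₁, .q₁ | .A, .q₁, .p₁ => G₁
  | .B, .q₃, .q₂ | .B, .q₂, .q₃ => G₁ * G₃⁻¹
  | .A, .q₂, .q₁ | .A, .q₁, .q₂ => G₃⁻¹ * G₁
  | .B, .q₃, .p₂ | .B, .p₂, .q₃ => G₃⁻¹
  | .A, .p₂, .q₁ | .A, .q₁, .p₂ => G₂
  | .B, .p₂, .q₂ | .B, .q₂, .p₂ => G₂ * G₃⁻¹
  | .A, .p₂, .q₂ | .A, .q₂, .p₂ => G₂ * G₃⁻¹
  | .B, .p₁, .q₃ | .B, .q₃, .p₁ => G₁⁻¹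
  | _, _, _ => 1

/-- The holonomy of one crossing next to an edge is a quotient of two values of `develop`. Where this
is not the definition of `develop`, it is one of the two cycle relations. -/
lemma pathHolonomy_singleton {T : Tet} {s : Face} {v v' e e' : Vtx} (hne : e ≠ v)
    (hv : cross T s v = some v') (he : cross T s e = some e') :
    pathHolonomy T [s] = (develop T v e)⁻¹ * develop T.other v' e' := by
  have r₁ : G₂ = G₁ * (G₂ * G₃⁻¹) := by
    rw [← mul_assoc, G₁_mul_G₂, mul_inv_cancel_right]
  have r₂ : G₂ = G₃ * (G₁⁻¹ * (G₃⁻¹ * G₁)) := by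
    rw [← G₁_mul_G₃_inv_mul_G₂]
    simp [mul_assoc]
  have r₃ : G₂⁻¹ = G₃ * (G₂⁻¹ * G₁⁻¹) := by
    rw [inv_eq_iff_eq_inv]
    simpa [mul_assoc] using r₁
  have r₄ : G₂⁻¹ = G₁⁻¹ * (G₃ * (G₁ * G₃⁻¹)) := by
    rw [inv_eq_iff_eq_inv]
    simpa [mul_assoc] using r₂
  cases T <;> cases s <;> cases v <;> simp [cross, glue, glueInv] at hv <;> subst hv <;>
    cases e <;> simp [cross, glue, glueInv] at he hne <;> subst he <;>
    simp [pathHolonomy, develop, Face.pairing, Tet.other, mul_assoc]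
  all_goals first | exact r₁ | exact r₂ | exact r₃ | exact r₄

lemma pathHolonomy_cons (T : Tet) (s : Face) (l : List Face) :
    pathHolonomy T (s :: l) = pathHolonomy T [s] * pathHolonomy T.other l := by
  cases T <;> simp [pathHolonomy, Tet.other]

lemma pathHolonomy_append {x y : Tet × Vtx} {l : List Face} (h : walk x l = some y)
    (m : List Face) : pathHolonomy x.1 (l ++ m) = pathHolonomy x.1 l * pathHolonomy y.1 m := by
  induction l generalizing x with
  | nil =>
    obtain rfl : x = y := by simpa [walk] using h
    obtain ⟨T, v⟩ := x
    cases T <;> simp [pathHolonomy]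
  | cons s l ih =>
    rw [walk, Option.bind_eq_some_iff] at h
    obtain ⟨v, -, h⟩ := h
    have := ih h
    rw [List.cons_append, pathHolonomy_cons, pathHolonomy_cons _ s l, mul_assoc, ← this]

lemma pathHolonomy_cornerWalk {x y : Tet × Vtx × Vtx} {l : List Face} (hne : x.2.2 ≠ x.2.1)
    (h : cornerWalk x l = some y) :
    pathHolonomy x.1 l = (develop x.1 x.2.1 x.2.2)⁻¹ * develop y.1 y.2.1 y.2.2 := by
  induction l generalizing x with
  | nil =>
    obtain rfl : x = y := by simpa [cornerWalk] using h
    obtain ⟨T, v⟩ := x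
    cases T <;> simp [pathHolonomy]
  | cons s l ih =>
    rw [cornerWalk, Option.bind_eq_some_iff] at h
    obtain ⟨v, hv, h⟩ := h
    rw [Option.bind_eq_some_iff] at h
    obtain ⟨e, he, h⟩ := h
    have hne' : e ≠ v := by
      rintro rfl
      exact hne (Option.some_injective _ ((cross_symm he).symm.trans (cross_symm hv)))
    rw [pathHolonomy_cons, pathHolonomy_singleton hne hv he, ih hne' h, mul_assoc,
      mul_inv_cancel_left]

lemma IsCornerLoop.pathHolonomy_eq_one {x : Tet × Vtx} {r : List Face} (h : IsCornerLoop x r) :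
    pathHolonomy x.1 r = 1 := by
  obtain ⟨e, hne, hr⟩ := h
  rw [pathHolonomy_cornerWalk hne hr, inv_mul_cancel]

lemma walk_of_cornerWalk {x y : Tet × Vtx × Vtx} {l : List Face} (h : cornerWalk x l = some y) :
    walk (x.1, x.2.1) l = some (y.1, y.2.1) := by
  induction l generalizing x with
  | nil =>
    obtain rfl : x = y := by simpa [cornerWalk] using h
    rfl
  | cons s l ih =>
    rw [cornerWalk, Option.bind_eq_some_iff] at h
    obtain ⟨v, hv, h⟩ := h
    rw [Option.bind_eq_some_iff] at h
    obtain ⟨e, -, h⟩ := h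
    rw [walk, hv]
    exact ih h

lemma IsCornerLoop.walk_eq {x : Tet × Vtx} {r : List Face} (h : IsCornerLoop x r) :
    walk x r = some x := by
  obtain ⟨e, -, hr⟩ := h
  exact walk_of_cornerWalk hr

lemma ElemHomotopy.holonomy_eq {a b : Loop} (h : ElemHomotopy a b) :
    a.holonomy = b.holonomy := by
  obtain ⟨u, r, w, y, hu, hr, ha, hb⟩ := h
  rw [Loop.holonomy, Loop.holonomy, ha, hb, pathHolonomy_append hu, pathHolonomy_append hu,
    pathHolonomy_append hr.walk_eq, hr.pathHolonomy_eq_one, one_mul]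

/-- The holonomy, as a homomorphism on the fundamental group of the link. -/
def holonomyHom : LinkGroup →* PU21 :=
  MonoidHom.mk' (Quot.lift Loop.holonomy fun _ _ h => h.holonomy_eq) (by
    rintro ⟨a⟩ ⟨b⟩
    exact pathHolonomy_append a.2 b.1)

/-! ### Generators of the fundamental group of the link -/

open scoped Classical in
/-- The homotopy class of a word of faces that describes a closed path at the base triangle; the
value is `1` if the word does not describe such a path. -/
def classOf (l : List Face) : LinkGroup :=
  if h : walk basePt l = some basePt then LinkGroup.mk ⟨l, h⟩ else 1

lemma classOf_of_walk {l : List Face} (h : walk basePt l = some basePt) :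
    classOf l = LinkGroup.mk ⟨l, h⟩ := dif_pos h

lemma classOf_nil : classOf [] = 1 := classOf_of_walk rfl

lemma classOf_append {l m : List Face} (hl : walk basePt l = some basePt)
    (hm : walk basePt m = some basePt) : classOf (l ++ m) = classOf l * classOf m := by
  rw [classOf_of_walk hl, classOf_of_walk hm,
    classOf_of_walk (by rw [walk_append, hl]; exact hm)]
  rfl

lemma classOf_remove {u r w : List Face} {y : Tet × Vtx} (hu : walk basePt u = some y)
    (hr : IsCornerLoop y r) (hw : walk y w = some basePt) :
    classOf (u ++ (r ++ w)) = classOf (u ++ w) := by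
  have h₁ : walk basePt (u ++ (r ++ w)) = some basePt := by
    rw [walk_append, hu, Option.bind_some, walk_append, hr.walk_eq]
    exact hw
  have h₂ : walk basePt (u ++ w) = some basePt := by
    rw [walk_append, hu]
    exact hw
  rw [classOf_of_walk h₁, classOf_of_walk h₂]
  exact Quot.sound ⟨u, r, w, y, hu, hr, rfl, rfl⟩

/-- A path followed by its reverse can be removed. -/
lemma classOf_backtrack {u l w : List Face} {x y : Tet × Vtx} (hu : walk basePt u = some x)
    (hl : walk x l = some y) (hw : walk x w = some basePt) :
    classOf (u ++ (l ++ (l.reverse ++ w))) = classOf (u ++ w) := by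
  induction l generalizing u w x with
  | nil => rfl
  | cons s l ih =>
    rw [walk, Option.bind_eq_some_iff] at hl
    obtain ⟨v, hv, hl⟩ := hl
    have hu' : walk basePt (u ++ [s]) = some (x.1.other, v) := by
      rw [walk_append, hu]
      simp [walk, hv]
    have hw' : walk (x.1.other, v) (s :: w) = some basePt := by
      rw [walk, cross_symm hv, Option.bind_some, other_other]
      exact hw
    have hs : IsCornerLoop x [s, s] := by
      obtain ⟨e, e', hne, he⟩ := exists_corner hv
      exact ⟨e, hne, by simp [cornerWalk, hv, he, cross_symm hv, cross_symm he, other_other]⟩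
    have h := ih hu' hl hw'
    have h' := classOf_remove hu hs hw
    simp only [List.append_assoc, List.cons_append, List.nil_append, List.reverse_cons] at h h' ⊢
    rw [h, h']

/-- A path from the base triangle to each triangle of the link: the initial segment of the closed
path of `H₁`, which visits each of the eight triangles once. (The two pairs `(T, v)` for which `v`
is not a vertex of `T` do not matter.) -/
def treePath : Tet × Vtx → List Face
  | (.B, .q₃) => [.g₁]
  | (.A, .p₁) => [.g₁, .g₃]
  | (.B, .p₁) => [.g₁, .g₃, .g₁]
  | (.A, .p₂) => [.g₁, .g₃, .g₁, .g₂]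
  | (.B, .p₂) => [.g₁, .g₃, .g₁, .g₂, .g₃]
  | (.A, .q₁) => [.g₁, .g₃, .g₁, .g₂, .g₃, .g₁]
  | (.B, .q₂) => [.g₁, .g₃, .g₁, .g₂, .g₃, .g₁, .g₃]
  | _ => []

/-- A triangle of the link is reached from the base triangle by its tree path. -/
def IsTriangle (x : Tet × Vtx) : Prop := walk basePt (treePath x) = some x

lemma isTriangle_of_cross {T : Tet} {s : Face} {v v' : Vtx} (h : cross T s v = some v') :
    IsTriangle (T.other, v') := by
  cases T <;> cases s <;> cases v <;> simp [cross, glue, glueInv] at h <;> subst h <;> rfl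

lemma IsTriangle.of_walk {x y : Tet × Vtx} {l : List Face} (hx : IsTriangle x)
    (h : walk x l = some y) : IsTriangle y := by
  induction l generalizing x with
  | nil =>
    obtain rfl : x = y := by simpa [walk] using h
    exact hx
  | cons s l ih =>
    rw [walk, Option.bind_eq_some_iff] at h
    obtain ⟨v, hv, h⟩ := h
    exact ih (isTriangle_of_cross hv) h

/-- The class of a path `l` from the triangle `x` to the triangle `y`, closed up by the tree paths
of its ends. -/
def closeUp (x y : Tet × Vtx) (l : List Face) : LinkGroup :=
  classOf (treePath x ++ (l ++ (treePath y).reverse))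

section closeUp

variable {x y z : Tet × Vtx} {l m : List Face}

lemma closeUp_append (hx : IsTriangle x) (hl : walk x l = some y) (hm : walk y m = some z) :
    closeUp x z (l ++ m) = closeUp x y l * closeUp y z m := by
  have hy := hx.of_walk hl
  have hz := hy.of_walk hm
  have h₁ : walk basePt (treePath x ++ l) = some y := by rw [walk_append, hx]; exact hl
  have h₂ : walk y (m ++ (treePath z).reverse) = some basePt := by
    rw [walk_append, hm]; exact walk_reverse hz
  have h := classOf_backtrack h₁ (walk_reverse hy) h₂
  rw [closeUp, closeUp, closeUp, ← classOf_append]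
  · rw [List.reverse_reverse] at h
    simp only [List.append_assoc] at h ⊢
    exact h.symm
  · rw [← List.append_assoc, walk_append, h₁]
    exact walk_reverse hy
  · rw [walk_append, hy]
    exact h₂

lemma closeUp_eq_one_of_isCornerLoop (hx : IsTriangle x) (hl : IsCornerLoop x l) :
    closeUp x x l = 1 := by
  rw [closeUp, classOf_remove hx hl (walk_reverse hx)]
  have h := classOf_backtrack (u := []) (w := []) rfl hx rfl
  simpa [classOf_nil] using h

lemma closeUp_nil (hx : IsTriangle x) : closeUp x x [] = 1 := by
  have h := classOf_backtrack (u := []) (w := []) rfl hx rfl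
  simpa [closeUp, classOf_nil] using h

lemma closeUp_reverse (hx : IsTriangle x) (hl : walk x l = some y) :
    closeUp y x l.reverse = (closeUp x y l)⁻¹ := by
  rw [eq_inv_iff_mul_eq_one, ← closeUp_append (hx.of_walk hl) (walk_reverse hl) hl]
  have hy := hx.of_walk hl
  have h := classOf_backtrack hy (walk_reverse hl) (walk_reverse hy)
  rw [List.reverse_reverse] at h
  rw [← closeUp_nil hy, closeUp, List.append_assoc, h]
  rfl

/-- Paths along the tree are trivial. -/
lemma closeUp_eq_one_of_treePath_append (h : treePath x ++ l = treePath y)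
    (hy : IsTriangle y) : closeUp x y l = 1 := by
  rw [closeUp, ← List.append_assoc, h, ← closeUp_nil hy]
  rfl

end closeUp

/-- The class of the closed path of `H₁`. -/
def ringClass : LinkGroup := closeUp (.B, .q₂) (.A, .q₂) [.c]

/-- The class of the closed path of `H₂`. -/
def stepClass : LinkGroup := closeUp (.A, .q₂) (.B, .q₃) [.g₂]

lemma holonomyHom_ringClass : holonomyHom ringClass = H₁ := by
  rw [ringClass, closeUp, classOf_of_walk rfl]
  change pathHolonomy .A [.g₁, .g₃, .g₁, .g₂, .g₃, .g₁, .g₃, .c] = H₁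
  simp [pathHolonomy, Face.pairing, H₁, mul_assoc]

lemma holonomyHom_stepClass : holonomyHom stepClass = H₂ := by
  rw [stepClass, closeUp, classOf_of_walk rfl]
  change pathHolonomy .A [.g₂, .g₁] = H₂
  simp [pathHolonomy, Face.pairing, H₂]

lemma closeUp_eq_one_of_treePath_append_reverse {x y : Tet × Vtx} {l : List Face}
    (hx : IsTriangle x) (hy : IsTriangle y) (h : treePath y ++ l.reverse = treePath x) :
    closeUp x y l = 1 := by
  have hl : walk y l.reverse = some x := by
    have h' : walk basePt (treePath y ++ l.reverse) = some x := by rw [h]; exact hx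
    rwa [walk_append, hy] at h'
  have := closeUp_reverse hy hl
  rwa [List.reverse_reverse, closeUp_eq_one_of_treePath_append h hx, inv_one] at this

/-- The relation of a vertex of the link, for a closed path around it that consists of four pieces, of
which the second and the fourth run along the tree. -/
lemma closeUp_four {x y z w : Tet × Vtx} {k l m n : List Face} (hx : IsTriangle x)
    (e : Vtx) (he : e ≠ x.2)
    (hr : cornerWalk (x.1, x.2, e) (k ++ (l ++ (m ++ n))) = some (x.1, x.2, e))
    (hk : walk x k = some y) (hl : walk y l = some z) (hm : walk z m = some w)
    (hn : walk w n = some x) (hl' : closeUp y z l = 1) (hn' : closeUp w x n = 1) :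
    closeUp x y k * closeUp z w m = 1 := by
  have hy := hx.of_walk hk
  have hz := hy.of_walk hl
  rw [← closeUp_eq_one_of_isCornerLoop hx ⟨e, he, hr⟩,
    closeUp_append hx hk (z := x)
      (by rw [walk_append, hl, Option.bind_some, walk_append, hm]; exact hn),
    closeUp_append hy hl (z := x) (by rw [walk_append, hm]; exact hn),
    closeUp_append hz hm hn, hl', hn', one_mul, mul_one]

lemma closeUp_A_p₁ : closeUp (.A, .p₁) (.B, .p₁) [.c] = stepClass := by
  have h := closeUp_four (x := (.A, .p₁)) (y := (.B, .p₁)) (z := (.B, .q₃)) (w := (.A, .q₂))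
    (k := [.c]) (l := [.g₁, .g₃]) (m := [.g₂]) (n := [.g₁, .g₃]) rfl .p₂ (by simp)
    rfl rfl rfl rfl rfl (closeUp_eq_one_of_treePath_append_reverse rfl rfl rfl)
    (closeUp_eq_one_of_treePath_append rfl rfl)
  have h' := closeUp_reverse (x := (.A, .q₂)) (y := (.B, .q₃)) (l := [.g₂]) rfl rfl
  rw [List.reverse_singleton] at h'
  rwa [h', mul_inv_eq_one] at h

lemma closeUp_A_p₂ : closeUp (.A, .p₂) (.B, .p₂) [.c] = stepClass := by
  have h := closeUp_four (x := (.A, .p₁)) (y := (.B, .p₁)) (z := (.B, .p₂)) (w := (.A, .p₂))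
    (k := [.c]) (l := [.g₂, .g₃]) (m := [.c]) (n := [.g₂, .g₁]) rfl .q₂ (by simp)
    rfl rfl rfl rfl rfl (closeUp_eq_one_of_treePath_append rfl rfl)
    (closeUp_eq_one_of_treePath_append_reverse rfl rfl rfl)
  have h' := closeUp_reverse (x := (.A, .p₂)) (y := (.B, .p₂)) (l := [.c]) rfl rfl
  rw [List.reverse_singleton] at h'
  rw [h', mul_inv_eq_one, closeUp_A_p₁] at h
  exact h.symm

lemma closeUp_A_q₁ : closeUp (.A, .q₁) (.B, .q₂) [.g₂] = stepClass := by
  have h := closeUp_four (x := (.A, .p₂)) (y := (.B, .p₂)) (z := (.B, .q₂)) (w := (.A, .q₁))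
    (k := [.c]) (l := [.g₁, .g₃]) (m := [.g₂]) (n := [.g₁, .g₃]) rfl .p₁ (by simp)
    rfl rfl rfl rfl rfl (closeUp_eq_one_of_treePath_append rfl rfl)
    (closeUp_eq_one_of_treePath_append_reverse rfl rfl rfl)
  have h' := closeUp_reverse (x := (.A, .q₁)) (y := (.B, .q₂)) (l := [.g₂]) rfl rfl
  rw [List.reverse_singleton] at h'
  rw [h', mul_inv_eq_one, closeUp_A_p₂] at h
  exact h.symm

/-- The relation of the fourth vertex of the link, where the ring of triangles closes up. -/
lemma commute_ringClass_stepClass : Commute ringClass stepClass := by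
  have h := closeUp_four (x := (.A, .q₁)) (y := (.A, .q₂)) (z := (.B, .q₃)) (w := (.B, .q₂))
    (k := [.g₂, .c]) (l := [.g₁]) (m := [.g₂, .c]) (n := [.g₃]) rfl .p₂ (by simp)
    rfl rfl rfl rfl rfl (closeUp_eq_one_of_treePath_append rfl rfl)
    (closeUp_eq_one_of_treePath_append_reverse rfl rfl rfl)
  have h₁ : closeUp (.A, .q₁) (.A, .q₂) ([.g₂] ++ [.c]) = stepClass * ringClass := by
    rw [closeUp_append (x := (.A, .q₁)) (y := (.B, .q₂)) (z := (.A, .q₂)) rfl rfl rfl,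
      closeUp_A_q₁, ringClass]
  have h₂ : closeUp (.B, .q₃) (.B, .q₂) [.g₂, .c] = (ringClass * stepClass)⁻¹ := by
    have h' := closeUp_reverse (x := (.B, .q₂)) (y := (.B, .q₃)) (l := [.c] ++ [.g₂]) rfl rfl
    rwa [closeUp_append (x := (.B, .q₂)) (y := (.A, .q₂)) (z := (.B, .q₃)) rfl rfl rfl] at h'
  rw [List.singleton_append] at h₁
  rw [h₁, h₂, mul_inv_eq_one] at h
  exact h.symm

lemma closeUp_singleton_mem_of_A {s : Face} {v v' : Vtx} (h : cross .A s v = some v') :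
    closeUp (.A, v) (.B, v') [s] ∈ Subgroup.closure {ringClass, stepClass} := by
  have ha : ringClass ∈ Subgroup.closure {ringClass, stepClass} :=
    Subgroup.subset_closure (Set.mem_insert _ _)
  have hb : stepClass ∈ Subgroup.closure {ringClass, stepClass} :=
    Subgroup.subset_closure (Set.mem_insert_of_mem _ rfl)
  have hc : closeUp (.A, .q₂) (.B, .q₂) [.c] = ringClass⁻¹ :=
    closeUp_reverse (x := (.B, .q₂)) (y := (.A, .q₂)) (l := [.c]) rfl rfl
  cases s <;> cases v <;> simp [cross, glue] at h <;> subst h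
  · exact closeUp_A_p₁ ▸ hb
  · exact closeUp_A_p₂ ▸ hb
  · exact hc ▸ inv_mem ha
  -- The crossings of `g₁` and `g₃` and that of `g₂` at `p₂` belong to the tree.
  case g₂.q₁ => exact closeUp_A_q₁ ▸ hb
  case g₂.q₂ => exact hb
  all_goals
    refine (?_ : closeUp _ _ _ = 1) ▸ one_mem _
    first
    | exact closeUp_eq_one_of_treePath_append rfl rfl
    | exact closeUp_eq_one_of_treePath_append_reverse rfl rfl rfl

lemma closeUp_singleton_mem {x y : Tet × Vtx} {s : Face} (h : walk x [s] = some y) :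
    closeUp x y [s] ∈ Subgroup.closure {ringClass, stepClass} := by
  obtain ⟨T, v⟩ := x
  rw [walk, Option.bind_eq_some_iff] at h
  obtain ⟨v', hv, h⟩ := h
  obtain rfl : (T.other, v') = y := Option.some_injective _ h
  cases T
  · exact closeUp_singleton_mem_of_A hv
  · have hv' := cross_symm hv
    have h' := closeUp_reverse (x := (.A, v')) (y := (.B, v)) (l := [s])
      (isTriangle_of_cross hv) (by simp [walk, show cross .A s v' = some v from hv', Tet.other])
    rw [List.reverse_singleton] at h'
    exact h' ▸ inv_mem (closeUp_singleton_mem_of_A hv')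

lemma closeUp_mem {x y : Tet × Vtx} {l : List Face} (hx : IsTriangle x)
    (h : walk x l = some y) : closeUp x y l ∈ Subgroup.closure {ringClass, stepClass} := by
  induction l generalizing x with
  | nil =>
    obtain rfl : x = y := by simpa [walk] using h
    exact closeUp_nil hx ▸ one_mem _
  | cons s l ih =>
    change walk x ([s] ++ l) = some y at h
    rw [walk_append, Option.bind_eq_some_iff] at h
    obtain ⟨z, hz, h⟩ := h
    rw [← List.singleton_append, closeUp_append hx hz h]
    exact mul_mem (closeUp_singleton_mem hz) (ih (hx.of_walk hz) h)

/-- Every closed path is the product of its crossings, each closed up by tree paths. -/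
lemma closure_ringClass_stepClass : Subgroup.closure {ringClass, stepClass} = ⊤ := by
  rw [eq_top_iff]
  rintro ⟨l, hl⟩ -
  have h := closeUp_mem (x := basePt) rfl hl
  rw [closeUp] at h
  change classOf ([] ++ (l ++ [])) ∈ _ at h
  rwa [List.nil_append, List.append_nil, classOf_of_walk hl] at h

/-! ### Pairs of commuting elements, and the translation lattice -/

lemma zpow_add_mul_zpow_add {G : Type*} [Group G] {g h : G} (hc : Commute g h)
    (m n m' n' : ℤ) : g ^ (m + m') * h ^ (n + n') = g ^ m * h ^ n * (g ^ m' * h ^ n') := by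
  rw [zpow_add, zpow_add]
  exact (hc.zpow_zpow m' n).mul_mul_mul_comm _ _

/-- The homomorphism `(m, n) ↦ g ^ m * h ^ n` of two commuting elements. -/
def zpowPairHom {G : Type*} [Group G] {g h : G} (hc : Commute g h) :
    Multiplicative (ℤ × ℤ) →* G :=
  MonoidHom.mk' (fun p => g ^ p.toAdd.1 * h ^ p.toAdd.2) fun p q =>
    zpow_add_mul_zpow_add hc p.toAdd.1 p.toAdd.2 q.toAdd.1 q.toAdd.2

lemma zpowPairHom_apply {G : Type*} [Group G] {g h : G} (hc : Commute g h)
    (p : Multiplicative (ℤ × ℤ)) :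
    zpowPairHom hc p = g ^ p.toAdd.1 * h ^ p.toAdd.2 := rfl

lemma range_zpowPairHom {G : Type*} [Group G] {g h : G} (hc : Commute g h) :
    (zpowPairHom hc).range = Subgroup.closure {g, h} := by
  apply le_antisymm
  · rintro _ ⟨p, rfl⟩
    have hg : g ∈ Subgroup.closure {g, h} := Subgroup.subset_closure (by simp)
    have hh : h ∈ Subgroup.closure {g, h} := Subgroup.subset_closure (by simp)
    rw [zpowPairHom_apply]
    exact mul_mem (zpow_mem hg _) (zpow_mem hh _)
  · rw [Subgroup.closure_le]
    rintro x (rfl | rfl)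
    · exact ⟨Multiplicative.ofAdd (1, 0), by simp [zpowPairHom_apply]⟩
    · exact ⟨Multiplicative.ofAdd (0, 1), by simp [zpowPairHom_apply]⟩

lemma map_zpowPairHom {G H : Type*} [Group G] [Group H] {g h : G} (hc : Commute g h)
    (f : G →* H) (p : Multiplicative (ℤ × ℤ)) :
    f (zpowPairHom hc p) = f g ^ p.toAdd.1 * f h ^ p.toAdd.2 := by
  simp [zpowPairHom_apply, map_zpow]

lemma commute_longTrans_shortTrans : Commute longTrans shortTrans := by
  ext
  · simp [longTrans, shortTrans, add_comm]
  · simp [longTrans, shortTrans, conj_ω]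
    ring

/-- The elements of the lattice lie on the vertical plane of `ω`, on which the Heisenberg product
is the addition. -/
lemma zpow_mk_smul_ω (r t : ℝ) (n : ℤ) :
    (⟨r * ω, t⟩ : Heis) ^ n = ⟨(n * r : ℝ) * ω, n * t⟩ := by
  let f : Multiplicative ℝ →* Heis := MonoidHom.mk'
    (fun s => ⟨(s.toAdd * r : ℝ) * ω, s.toAdd * t⟩) (by
      intro a b
      ext1
      · simp [add_mul]
      · simp
        ring)
  have h₁ : (⟨r * ω, t⟩ : Heis) = f (Multiplicative.ofAdd 1) := by simp [f]
  rw [h₁, ← map_zpow, ← ofAdd_zsmul]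
  simp [f]

/-- Coordinates on the translation lattice. -/
lemma zpowPairHom_trans (p : Multiplicative (ℤ × ℤ)) :
    zpowPairHom commute_longTrans_shortTrans p =
      ⟨(2 * p.toAdd.1 - p.toAdd.2 : ℝ) * ω, (2 * p.toAdd.1 + p.toAdd.2) * √3⟩ := by
  have h₁ := zpow_mk_smul_ω 2 (2 * √3) p.toAdd.1
  have h₂ := zpow_mk_smul_ω (-1) (√3) p.toAdd.2
  have e₁ : longTrans = ⟨(2 : ℝ) * ω, 2 * √3⟩ := by simp [longTrans]
  have e₂ : shortTrans = ⟨(-1 : ℝ) * ω, √3⟩ := by simp [shortTrans]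
  rw [zpowPairHom_apply, e₁, e₂, h₁, h₂]
  ext1
  · simp
    ring
  · simp
    ring

/-- The homomorphism `ℤ² → 𝔑` whose image is the translation lattice. -/
def latticeHom : Multiplicative (ℤ × ℤ) →* Heis := zpowPairHom commute_longTrans_shortTrans

lemma range_latticeHom : latticeHom.range = translationLattice :=
  range_zpowPairHom commute_longTrans_shortTrans

lemma latticeHom_t (p : Multiplicative (ℤ × ℤ)) :
    (latticeHom p).t = ((2 * p.toAdd.1 + p.toAdd.2 : ℤ) : ℝ) * √3 := by
  rw [latticeHom, zpowPairHom_trans]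
  push_cast
  rfl

lemma two_mul_latticeHom_z_re (p : Multiplicative (ℤ × ℤ)) :
    2 * (latticeHom p).z.re = ((2 * p.toAdd.1 - p.toAdd.2 : ℤ) : ℝ) := by
  rw [latticeHom, zpowPairHom_trans, Complex.re_ofReal_mul, ω_eq]
  push_cast
  ring

/-- Two elements of the lattice whose integral coordinates are close are equal. -/
lemma latticeHom_eq_of_abs_lt {p q : Multiplicative (ℤ × ℤ)}
    (hz : |2 * (latticeHom p).z.re - 2 * (latticeHom q).z.re| < 1)
    (ht : |(latticeHom p).t / √3 - (latticeHom q).t / √3| < 1) : p = q := by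
  have h3 : √3 ≠ 0 := by positivity
  rw [two_mul_latticeHom_z_re, two_mul_latticeHom_z_re, ← Int.cast_sub, ← Int.cast_abs] at hz
  rw [latticeHom_t, latticeHom_t, mul_div_cancel_right₀ _ h3, mul_div_cancel_right₀ _ h3,
    ← Int.cast_sub, ← Int.cast_abs] at ht
  have hz' := Int.abs_lt_one_iff.1 (by exact_mod_cast hz)
  have ht' := Int.abs_lt_one_iff.1 (by exact_mod_cast ht)
  apply Multiplicative.toAdd.injective
  apply Prod.ext <;> omega

lemma latticeHom_injective : Function.Injective latticeHom := fun p q h =>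
  latticeHom_eq_of_abs_lt (by simp [h]) (by simp [h])

lemma discreteTopology_translationLattice : DiscreteTopology translationLattice := by
  rw [← range_latticeHom, discreteTopology_iff_isOpen_singleton]
  rintro ⟨_, q, rfl⟩
  have h : Continuous fun a : Heis => (a.z, a.t) := continuous_induced_dom
  have hc : Continuous fun a : latticeHom.range => ((a : Heis).z, (a : Heis).t) :=
    h.comp continuous_subtype_val
  have hz : Continuous fun a : latticeHom.range => 2 * (a : Heis).z.re :=
    continuous_const.mul (Complex.continuous_re.comp (continuous_fst.comp hc))
  have ht : Continuous fun a : latticeHom.range => (a : Heis).t / √3 :=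
    (continuous_snd.comp hc).div_const _
  convert (isOpen_lt (hz.sub (continuous_const (y := 2 * (latticeHom q).z.re))).abs
      (continuous_const (y := (1 : ℝ)))).inter
    (isOpen_lt (ht.sub (continuous_const (y := (latticeHom q).t / √3))).abs
      (continuous_const (y := (1 : ℝ)))) using 1
  ext ⟨_, p, rfl⟩
  constructor
  · intro h
    obtain rfl : p = q := latticeHom_injective (congrArg Subtype.val h)
    simp
  · rintro ⟨h₁, h₂⟩
    obtain rfl := latticeHom_eq_of_abs_lt h₁ h₂
    rfl

lemma longTrans_mul_shortTrans_sq : longTrans * shortTrans ^ 2 = ⟨0, 4 * √3⟩ := by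
  have h := zpowPairHom_trans (Multiplicative.ofAdd (1, 2))
  simp only [zpowPairHom_apply, toAdd_ofAdd, zpow_ofNat, pow_one] at h
  rw [h]
  ext1
  · simp
  · norm_num

/-! ### Faithfulness and parabolicity -/

/-- The homomorphism from `ℤ²` onto the fundamental group of the link. -/
def linkHom : Multiplicative (ℤ × ℤ) →* LinkGroup := zpowPairHom commute_ringClass_stepClass

lemma linkHom_surjective : Function.Surjective linkHom := by
  rw [← MonoidHom.range_eq_top, linkHom, range_zpowPairHom, closure_ringClass_stepClass]

lemma range_holonomyHom : holonomyHom.range = Subgroup.closure {H₁, H₂} := by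
  rw [MonoidHom.range_eq_map, ← closure_ringClass_stepClass, MonoidHom.map_closure,
    Set.image_pair, holonomyHom_ringClass, holonomyHom_stepClass]

/-- Conjugation by `κ` turns the holonomy into the translations of the lattice. -/
lemma κ_conj_holonomyHom_linkHom (p : Multiplicative (ℤ × ℤ)) :
    κ * holonomyHom (linkHom p) * κ⁻¹ = heisTrans (latticeHom p) := by
  have h := map_zpowPairHom commute_ringClass_stepClass
    ((MulAut.conj κ).toMonoidHom.comp holonomyHom) p
  simp only [MonoidHom.comp_apply, MulEquiv.toMonoidHom_eq_coe, MonoidHom.coe_coe,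
    MulAut.conj_apply, holonomyHom_ringClass, holonomyHom_stepClass, κ_conj_H₁, κ_conj_H₂] at h
  rw [latticeHom, map_zpowPairHom]
  exact h

lemma isParabolic_holonomyHom {x : LinkGroup} (hx : x ≠ 1) : IsParabolic (holonomyHom x) := by
  obtain ⟨p, rfl⟩ := linkHom_surjective x
  have hp : latticeHom p ≠ 1 := fun h => hx (by
    rw [latticeHom_injective (h.trans (map_one latticeHom).symm), map_one])
  have h := (isParabolic_heisTrans hp).conj κ⁻¹
  rw [← κ_conj_holonomyHom_linkHom p] at h
  simpa [mul_assoc] using h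

lemma holonomyHom_injective : Function.Injective holonomyHom := by
  rw [injective_iff_map_eq_one]
  intro x hx
  by_contra h
  exact not_isParabolic_one (hx ▸ isParabolic_holonomyHom h)

end FigEight

end

theorem mainTheorem3 :
    -- the isometries `G₁, G₂, G₃` are the side pairings of the two tetrahedra
    (∀ (s : FigEight.Face) (v v' : FigEight.Vtx), FigEight.cross .A s v = some v' →
      s.pairing • FigEight.stereo v.pos = FigEight.stereo v'.pos) ∧
    -- the holonomy is well defined on the fundamental group of the link, and there it is
    -- faithful, parabolic, and generated by `H₁` and `H₂`
    (∃ ρ : FigEight.LinkGroup →* FigEight.PU21,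
      (∀ a : FigEight.Loop, ρ (FigEight.LinkGroup.mk a) = a.holonomy) ∧
      Function.Injective ρ ∧
      (∀ x : FigEight.LinkGroup, x ≠ 1 → FigEight.IsParabolic (ρ x)) ∧
      ρ.range = Subgroup.closure {FigEight.H₁, FigEight.H₂}) ∧
    -- the isometry `κ` places the vertex `q₂ = 0` at infinity; there `H₁`, `H₂` and `H₁ H₂²` are
    -- Heisenberg translations
    FigEight.κ • FigEight.stereo FigEight.Vtx.q₂.pos = FigEight.stereo OnePoint.infty ∧
    FigEight.IsHeisTranslation (FigEight.κ * FigEight.H₁ * FigEight.κ⁻¹)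
      ⟨2 * FigEight.ω, 2 * √3⟩ ∧
    FigEight.IsHeisTranslation (FigEight.κ * FigEight.H₂ * FigEight.κ⁻¹)
      ⟨-FigEight.ω, √3⟩ ∧
    FigEight.IsHeisTranslation (FigEight.κ * (FigEight.H₁ * FigEight.H₂ ^ 2) * FigEight.κ⁻¹)
      ⟨0, 4 * √3⟩ ∧
    -- the translations generate a lattice of rank two
    Nonempty (FigEight.translationLattice ≃* Multiplicative (ℤ × ℤ)) ∧
    DiscreteTopology FigEight.translationLattice ∧
    (⟨0, 4 * √3⟩ : FigEight.Heis) ∈ FigEight.translationLattice ∧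
    FigEight.translationLattice = Subgroup.closure {⟨-FigEight.ω, √3⟩, ⟨0, 4 * √3⟩} := by
  open FigEight in
  have hα : longTrans ∈ translationLattice := Subgroup.subset_closure (Set.mem_insert _ _)
  have hβ : shortTrans ∈ translationLattice :=
    Subgroup.subset_closure (Set.mem_insert_of_mem _ (Set.mem_singleton _))
  have hδ : (⟨0, 4 * √3⟩ : Heis) ∈ translationLattice :=
    longTrans_mul_shortTrans_sq ▸ mul_mem hα (pow_mem hβ 2)
  refine ⟨pairing_smul_stereo, ⟨holonomyHom, fun _ => rfl, holonomyHom_injective,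
    fun _ => isParabolic_holonomyHom, range_holonomyHom⟩, κ_smul_stereo_q₂, ?_, ?_, ?_, ?_,
    discreteTopology_translationLattice, hδ, le_antisymm ?_ ?_⟩
  · rw [κ_conj_H₁]
    exact isHeisTranslation_heisTrans longTrans
  · rw [κ_conj_H₂]
    exact isHeisTranslation_heisTrans shortTrans
  · have h : κ * (H₁ * H₂ ^ 2) * κ⁻¹ = κ * H₁ * κ⁻¹ * (κ * H₂ * κ⁻¹) ^ 2 := by
      rw [conj_pow, conj_mul]
    rw [h, κ_conj_H₁, κ_conj_H₂, ← map_pow, ← map_mul, longTrans_mul_shortTrans_sq]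
    exact isHeisTranslation_heisTrans _
  · exact ⟨((MonoidHom.ofInjective latticeHom_injective).trans
      (MulEquiv.subgroupCongr range_latticeHom)).symm⟩
  · rw [translationLattice, Subgroup.closure_le]
    have hβ' : shortTrans ∈ Subgroup.closure {shortTrans, (⟨0, 4 * √3⟩ : Heis)} :=
      Subgroup.subset_closure (Set.mem_insert _ _)
    have hδ' : (⟨0, 4 * √3⟩ : Heis) ∈ Subgroup.closure {shortTrans, (⟨0, 4 * √3⟩ : Heis)} :=
      Subgroup.subset_closure (Set.mem_insert_of_mem _ (Set.mem_singleton _))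
    have hα' := mul_mem hδ' (inv_mem (pow_mem hβ' 2))
    rw [← longTrans_mul_shortTrans_sq, mul_inv_cancel_right,
      longTrans_mul_shortTrans_sq] at hα'
    rintro x (rfl | rfl)
    · exact hα'
    · exact hβ'
  · rw [Subgroup.closure_le]
    rintro x (rfl | rfl)
    · exact hβ
    · exact hδ
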